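/- **Conventions.** $\Gamma_0(\mathbb R^n)$ is the class of proper, lower semicontinuous, convex functions $\varphi:\mathbb R^n\to(-\infty,+\infty]$; $\mathcal F^1(\mathbb R^n)$ the class of continuously differentiable convex functions $\mathbb R^n\to\mathbb R$; $\mathcal F^{1,1}_L(\mathbb R^n)$ ($L>0$) the class of differentiable convex functions $\mathbb R^n\to\mathbb R$ with $L$-Lipschitz gradient. For such $\varphi$ let $\mathrm{dom}\,\varphi=\{\varphi<+\infty\}$, let $\partial\varphi(x)=\{v:\varphi(z)\ge\varphi(x)+\langle v,z-x\rangle\ \forall z\}$ for $x\in\mathrm{dom}\,\varphi$ and $\partial\varphi(x)=\emptyset$ otherwise, $\mathrm{dom}\,\partial\varphi=\{x:\partial\varphi(x)\ne\emptyset\}$, $\mathbf{crit}\,\varphi=\{x:0\in\partial\varphi(x)\}$, let $\partial^0\varphi(x)$ be the element of least norm of $\partial\varphi(x)$ for $x\in\mathrm{dom}\,\partial\varphi$, and let $\mathbf{prox}_{\lambda\varphi}(x)=\arg\min_y\{\varphi(y)+\frac1{2\lambda}\|y-x\|^2\}$. A subgradient curve of $\varphi$ from $x$ is a map $\chi:[0,\infty)\to\mathbb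 R^n$, absolutely continuous on each $[0,T]$, with $\chi(0)=x$ and $\dot\chi(t)\in-\partial\varphi(\chi(t))$ for a.e. $t>0$. We say that the flow of $\varphi$ from $x$ stays in $\Omega$ if every subgradient curve $\chi$ of $\varphi$ from $x$ satisfies $\chi(t)\in\Omega$ for a.e. $t>0$, and that $\Omega$ is $\partial\varphi$-invariant if the flow of $\varphi$ from every $x\in\Omega\cap\mathrm{dom}\,\partial\varphi$ stays in $\Omega$ ($\nabla\varphi$-invariant if $\partial\varphi=\{\nabla\varphi\}$). Let $\varphi$ attain its minimum $\min\varphi$, let $\Omega\subset X\subset\mathbb R^n$ and $G:X\to\mathbb R^n$. Write $d(x)$ for the distance from $x$ to $\mathbf{crit}\,\varphi$ and $\mathcal P(x)$ for the set of points of $\mathbf{crit}\,\varphi$ nearest to $x$. Consider the following conditions, each required for all $x\in\Omega\cap\mathrm{dom}\,\varphi$: - (cor-EB) with constant $\nu>0$: $\inf_{x_p\in\mathcal P(x)}\langle G(x),x-x_p\rangle\ge\nu\, d(x)^2$; - (res-EB) with constant $\kappa>0$: $\|G(x)\|\ge\kappa\, d(x)$; - (obj-EB) with constant $\alpha>0$: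 $\varphi(x)-\min\varphi\ge\frac\alpha2 d(x)^2$; - (res-obj-EB) with constant $\eta>0$: $\|G(x)\|\ge\eta\sqrt{\varphi(x)-\min\varphi}$. **Statement.** In each of the following situations $\mathbf{crit}\,\varphi$ is nonempty and closed, $\{x\in X:G(x)=0\}=\mathbf{crit}\,\varphi$, and the four conditions (cor-EB), (res-EB), (obj-EB), (res-obj-EB), each with some positive constant, are equivalent: 1. $\varphi\in\mathcal F^1(\mathbb R^n)$ attains its minimum, $X=\mathbb R^n$, $\Omega\subset X$ is $\nabla\varphi$-invariant, and $G=\nabla\varphi$; put $\omega=1$. 2. $\varphi\in\Gamma_0(\mathbb R^n)$ attains its minimum, $X=\mathrm{dom}\,\partial\varphi$, $\Omega\subset X$ is $\partial\varphi$-invariant, and $G=\partial^0\varphi$; put $\omega=1$. 3. $\varphi=f+g$ attains its minimum, where $f\in\mathcal F^{1,1}_L(\mathbb R^n)$ and $g\in\Gamma_0(\mathbb R^n)$; $X=\mathbb R^n$; $\Omega\subset X$ is such that the flow of $\varphi$ from every $x\in\Omega\cap\mathrm{dom}\,\varphi$ stays in $\Omega$; $G=\mathcal R_t$, where $t\in(0,\frac1L]$,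 $\mathcal R_t(x)=t^{-1}(x-x^+)$ and $x^+=\mathbf{prox}_{tg}(x-t\nabla f(x))$; and there is $0<\epsilon\le\frac2t$ with $\|\mathcal R_t(x)\|^2\ge\epsilon(\varphi(x)-\varphi(x^+))$ for all $x\in\Omega\cap\mathrm{dom}\,\varphi$; put $\omega=\frac{t\epsilon}2$. Moreover, in each situation: (obj-EB) with $\alpha$ implies (cor-EB) with $\nu=\frac{\alpha\omega}2$; (cor-EB) with $\nu$ implies (res-EB) with $\kappa=\nu$; (res-EB) with $\kappa$ implies (res-obj-EB) with $\eta=\sqrt{\kappa\omega}$; and (res-obj-EB) with $\eta$ implies (obj-EB) with $\alpha=\frac12\eta^2$. -/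

import Mathlib

open Set MeasureTheory

noncomputable section

namespace ErrorBound

variable {E : Type*} [NormedAddCommGroup E] [InnerProductSpace ℝ E]

/-! ### Extended-valued functions, subgradients, proximal points -/

/-- The effective domain `dom φ = {x | φ x < +∞}`. -/
def effDom (φ : E → EReal) : Set E := {x | φ x < ⊤}

/-- `φ ∈ Γ₀`: proper (never `-∞`, somewhere finite), lower semicontinuous and convex. -/
structure IsGammaZero (φ : E → EReal) : Prop where
  ne_bot : ∀ x, φ x ≠ ⊥
  dom_nonempty : (effDom φ).Nonempty
  lsc : LowerSemicontinuous φ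
  convex : ∀ x y : E, ∀ a b : ℝ, 0 < a → 0 < b → a + b = 1 →
    φ (a • x + b • y) ≤ (a : EReal) * φ x + (b : EReal) * φ y

/-- `f ∈ F¹`: continuously differentiable, convex and real-valued. -/
structure IsC1Convex [CompleteSpace E] (f : E → ℝ) : Prop where
  convex : ConvexOn ℝ univ f
  contDiff : ContDiff ℝ 1 f

/-- `f ∈ F^{1,1}_L`: real-valued, convex, differentiable, with `L`-Lipschitz gradient. -/
structure IsGradLipschitzConvex [CompleteSpace E] (L : ℝ) (f : E → ℝ) : Prop where
  convex : ConvexOn ℝ univ f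
  differentiable : Differentiable ℝ f
  lipschitz : ∀ x y, ‖gradient f x - gradient f y‖ ≤ L * ‖x - y‖

/-- The (convex) subdifferential; it is empty outside `dom φ`. -/
def subdiff (φ : E → EReal) (x : E) : Set E :=
  {v | x ∈ effDom φ ∧ ∀ z, φ x + ((inner ℝ v (z - x) : ℝ) : EReal) ≤ φ z}

/-- `dom ∂φ`. -/
def subdiffDom (φ : E → EReal) : Set E := {x | (subdiff φ x).Nonempty}

/-- The set of critical points `{x | 0 ∈ ∂φ(x)}`. -/
def crit (φ : E → EReal) : Set E := {x | (0 : E) ∈ subdiff φ x}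

/-- `φ` attains its minimum over the whole space. -/
def AttainsMin (φ : E → EReal) : Prop := ∃ x₀, ∀ x, φ x₀ ≤ φ x

/-- The element of `∂φ(x)` of least norm (it is unique; used for `x ∈ dom ∂φ` only). -/
def leastNormSubgrad (φ : E → EReal) (x : E) : E :=
  Classical.epsilon fun v => v ∈ subdiff φ x ∧ ∀ w ∈ subdiff φ x, ‖v‖ ≤ ‖w‖

/-- `prox_{λ g}(x)`, the unique minimizer of `y ↦ g(y) + (1/(2λ)) ‖y - x‖²`. -/
def prox (lam : ℝ) (g : E → EReal) (x : E) : E :=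
  Classical.epsilon fun y => ∀ z,
    g y + ((1 / (2 * lam) * ‖y - x‖ ^ 2 : ℝ) : EReal) ≤
      g z + ((1 / (2 * lam) * ‖z - x‖ ^ 2 : ℝ) : EReal)

/-- The forward-backward step `x⁺ = prox_{t g}(x - t ∇f(x))`. -/
def fbStep [CompleteSpace E] (f : E → ℝ) (g : E → EReal) (t : ℝ) (x : E) : E :=
  prox t g (x - t • gradient f x)

/-- The proximal-gradient residual `R_t(x) = t⁻¹ (x - x⁺)`. -/
def proxResidual [CompleteSpace E] (f : E → ℝ) (g : E → EReal) (t : ℝ) (x : E) : E :=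
  t⁻¹ • (x - fbStep f g t x)

/-! ### Subgradient curves and invariant sets -/

/-- `χ` restricted to `[0, ∞)` is a subgradient curve of `φ` issued from `x`: it is absolutely
continuous on every `[0, T]`, `χ 0 = x` and `χ'(t) ∈ -∂φ(χ(t))` for almost every `t > 0`. -/
structure IsSubgradCurve (φ : E → EReal) (x : E) (χ : ℝ → E) : Prop where
  init : χ 0 = x
  absCont : ∀ T : ℝ, 0 ≤ T → AbsolutelyContinuousOnInterval χ 0 T
  deriv_mem : ∀ᵐ t ∂(volume.restrict (Ioi (0 : ℝ))),
    ∃ v, HasDerivAt χ v t ∧ -v ∈ subdiff φ (χ t)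

/-- The subgradient curve of `φ` issued from `x` lies in `Ω` for almost every `t > 0`. -/
def FlowStaysIn (φ : E → EReal) (Ω : Set E) (x : E) : Prop :=
  ∀ χ : ℝ → E, IsSubgradCurve φ x χ → ∀ᵐ t ∂(volume.restrict (Ioi (0 : ℝ))), χ t ∈ Ω

/-- `Ω` is `∂φ`-invariant. -/
def IsSubdiffInvariant (φ : E → EReal) (Ω : Set E) : Prop :=
  ∀ x ∈ Ω ∩ subdiffDom φ, FlowStaysIn φ Ω x

/-! ### Error bound conditions -/

/-- `φ(x) - min φ` as a real number (used for `x ∈ dom φ`, when `φ` is proper and attains its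
minimum, so that both terms are finite). -/
def objGap (φ : E → EReal) (x : E) : ℝ := (φ x - ⨅ y, φ y).toReal

/-- The set of projections of `x` onto the critical set. -/
def critProj (φ : E → EReal) (x : E) : Set E :=
  {u | u ∈ crit φ ∧ ∀ v ∈ crit φ, ‖x - u‖ ≤ ‖x - v‖}

/-- `inf_{x_p} ⟨G(x), x - x_p⟩`, the infimum over the projections `x_p` of `x`. -/
def leastCorr (φ : E → EReal) (G : E → E) (x : E) : EReal :=
  ⨅ p ∈ critProj φ x, ((inner ℝ (G x) (x - p) : ℝ) : EReal)

/-- The (res-EB) inequality with constant `κ`. -/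
def ResEB (φ : E → EReal) (G : E → E) (κ : ℝ) (Ω : Set E) : Prop :=
  ∀ x ∈ Ω ∩ effDom φ, κ * Metric.infDist x (crit φ) ≤ ‖G x‖

/-- The (cor-EB) inequality with constant `ν`. -/
def CorEB (φ : E → EReal) (G : E → E) (ν : ℝ) (Ω : Set E) : Prop :=
  ∀ x ∈ Ω ∩ effDom φ, ((ν * Metric.infDist x (crit φ) ^ 2 : ℝ) : EReal) ≤ leastCorr φ G x

/-- The (obj-EB) inequality with constant `α`. -/
def ObjEB (φ : E → EReal) (α : ℝ) (Ω : Set E) : Prop :=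
  ∀ x ∈ Ω ∩ effDom φ, α / 2 * Metric.infDist x (crit φ) ^ 2 ≤ objGap φ x

/-- The (res-obj-EB) inequality with constant `η`. -/
def ResObjEB (φ : E → EReal) (G : E → E) (η : ℝ) (Ω : Set E) : Prop :=
  ∀ x ∈ Ω ∩ effDom φ, η * Real.sqrt (objGap φ x) ≤ ‖G x‖

/-- What the error bound conditions presuppose: the critical set is nonempty and closed, and `G`
is a residual measure operator related to `φ` and `X`. -/
def IsResidualSetting (φ : E → EReal) (X : Set E) (G : E → E) : Prop :=
  (crit φ).Nonempty ∧ IsClosed (crit φ) ∧ {x ∈ X | G x = 0} = crit φ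

/-- The four error bound conditions on `Ω`, each with some positive constant, are equivalent. -/
def EBEquivalent (φ : E → EReal) (G : E → E) (Ω : Set E) : Prop :=
  List.TFAE [∃ ν > 0, CorEB φ G ν Ω, ∃ κ > 0, ResEB φ G κ Ω, ∃ α > 0, ObjEB φ α Ω,
    ∃ η > 0, ResObjEB φ G η Ω]

/-- The cycle of implications between the four conditions with explicit constants. -/
def EBConstants (ω : ℝ) (φ : E → EReal) (G : E → E) (Ω : Set E) : Prop :=
  (∀ α > 0, ObjEB φ α Ω → CorEB φ G (α * ω / 2) Ω) ∧
  (∀ ν > 0, CorEB φ G ν Ω → ResEB φ G ν Ω) ∧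
  (∀ κ > 0, ResEB φ G κ Ω → ResObjEB φ G (Real.sqrt (κ * ω)) Ω) ∧
  (∀ η > 0, ResObjEB φ G η Ω → ObjEB φ (η ^ 2 / 2) Ω)

end ErrorBound

end

open ErrorBound

open ErrorBound

namespace ErrorBound

open Filter Topology

variable {E : Type*} [NormedAddCommGroup E] [InnerProductSpace ℝ E]

/-! ### Real-valued reformulations -/

/-! Write gap for `φ - min φ` and `d` for the distance to `crit φ`. Two facts about `G` on `Ω ∩ dom
φ` suffice: `ω * gap ≤ ⟪G x, x - p⟫` for every critical `p`, and `‖G x‖ ≤ ‖v‖` for every subgradient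
`v` at `x`. The first, with Cauchy–Schwarz at a nearest critical point, gives pointwise every
implication of the cycle obj → cor → res → res-obj → obj except the last.

The last one uses the flow. Along a subgradient curve `χ` put `q = √gap`; then `2 q q' = -‖χ'‖²`,
and the residual bound `η q ≤ ‖χ'‖` turns this into `η ‖χ'‖ ≤ -2 q'`. Integration bounds the
displacement by `2 q(0) / η` and forces `q → 0`, so a cluster point is a minimizer `c` with `η ‖x -
c‖ ≤ 2 √gap(x)` (`IsEVICurve.exists_crit_norm_sub_le`).

Invariance only speaks of curves that exist, so one is built from each point of `dom φ`: implicit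
Euler (proximal) iterates satisfy a discrete evolution variational inequality (EVI), which survives
an ultrafilter limit (`IsGammaZero.exists_evi_curve`) and implies absolute continuity and the
subgradient inclusion (`IsEVICurve.isSubgradCurve`).

For the least-norm subgradient both facts are immediate with `ω = 1`; for the proximal-gradient
residual they are `le_inner_proxResidual` combined with the decrease hypothesis, and
`norm_proxResidual_le`. -/

lemma mem_subdiff_iff {φ : E → EReal} (hb : ∀ x, φ x ≠ ⊥) {x v : E} :
    v ∈ subdiff φ x ↔ φ x < ⊤ ∧
      ∀ z, φ z < ⊤ → (φ x).toReal + inner ℝ v (z - x) ≤ (φ z).toReal := by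
  have key : ∀ z, φ x < ⊤ → φ z < ⊤ →
      (φ x + ((inner ℝ v (z - x) : ℝ) : EReal) ≤ φ z ↔
        (φ x).toReal + inner ℝ v (z - x) ≤ (φ z).toReal) := by
    intro z hx hz
    rw [← EReal.coe_toReal hx.ne (hb x), ← EReal.coe_toReal hz.ne (hb z), ← EReal.coe_add,
      EReal.coe_le_coe_iff, EReal.toReal_coe, EReal.toReal_coe]
  constructor
  · rintro ⟨hx, h⟩
    exact ⟨hx, fun z hz => (key z hx hz).1 (h z)⟩
  · rintro ⟨hx, h⟩
    refine ⟨hx, fun z => ?_⟩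
    by_cases hz : φ z < ⊤
    · exact (key z hx hz).2 (h z hz)
    · rw [not_lt_top_iff.1 hz]; exact le_top

lemma IsGammaZero.toReal_convex {φ : E → EReal} (h : IsGammaZero φ) {x y : E} {a b : ℝ}
    (ha : 0 < a) (hb : 0 < b) (hab : a + b = 1) (hx : φ x < ⊤) (hy : φ y < ⊤) :
    φ (a • x + b • y) < ⊤ ∧
      (φ (a • x + b • y)).toReal ≤ a * (φ x).toReal + b * (φ y).toReal := by
  have key := h.convex x y a b ha hb hab
  rw [← EReal.coe_toReal hx.ne (h.ne_bot x), ← EReal.coe_toReal hy.ne (h.ne_bot y),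
    ← EReal.coe_mul, ← EReal.coe_mul, ← EReal.coe_add] at key
  have hlt := lt_of_le_of_lt key (EReal.coe_lt_top _)
  refine ⟨hlt, ?_⟩
  rwa [← EReal.coe_toReal hlt.ne (h.ne_bot _), EReal.coe_le_coe_iff] at key

omit [InnerProductSpace ℝ E] in
lemma isClosed_sublevel {φ : E → EReal} (h : LowerSemicontinuous φ) (c : EReal) :
    IsClosed {x | φ x ≤ c} := h.isClosed_preimage c

lemma mem_crit_iff {φ : E → EReal} {x : E} : x ∈ crit φ ↔ φ x < ⊤ ∧ ∀ z, φ x ≤ φ z := by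
  simp [crit, subdiff, effDom]

lemma IsGammaZero.mem_crit_iff_forall_le {φ : E → EReal} (h : IsGammaZero φ) {x : E} :
    x ∈ crit φ ↔ ∀ z, φ x ≤ φ z := by
  rw [mem_crit_iff]
  refine ⟨fun h => h.2, fun hx => ⟨?_, hx⟩⟩
  obtain ⟨y, hy⟩ := h.dom_nonempty
  exact (hx y).trans_lt hy

lemma IsGammaZero.crit_nonempty {φ : E → EReal} (h : IsGammaZero φ) (hm : AttainsMin φ) :
    (crit φ).Nonempty := by
  obtain ⟨x, hx⟩ := hm
  exact ⟨x, h.mem_crit_iff_forall_le.2 hx⟩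

lemma IsGammaZero.isClosed_crit {φ : E → EReal} (h : IsGammaZero φ) : IsClosed (crit φ) := by
  have : crit φ = {x | φ x ≤ ⨅ z, φ z} := by
    ext x
    rw [h.mem_crit_iff_forall_le, mem_ofPred_eq, le_iInf_iff]
  rw [this]
  exact isClosed_sublevel h.lsc _

lemma iInf_eq_of_mem_crit {φ : E → EReal} {p : E} (hp : p ∈ crit φ) : ⨅ y, φ y = φ p :=
  le_antisymm (iInf_le _ _) (le_iInf (mem_crit_iff.1 hp).2)

lemma IsGammaZero.objGap_eq {φ : E → EReal} (h : IsGammaZero φ) {p x : E} (hp : p ∈ crit φ)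
    (hx : φ x < ⊤) : objGap φ x = (φ x).toReal - (φ p).toReal := by
  rw [objGap, iInf_eq_of_mem_crit hp,
    EReal.toReal_sub hx.ne (h.ne_bot x) (mem_crit_iff.1 hp).1.ne (h.ne_bot p)]

lemma IsGammaZero.toReal_le {φ : E → EReal} (h : IsGammaZero φ) {p x : E} (hp : p ∈ crit φ)
    (hx : φ x < ⊤) : (φ p).toReal ≤ (φ x).toReal :=
  EReal.toReal_le_toReal ((mem_crit_iff.1 hp).2 x) (h.ne_bot p) hx.ne

/-! ### Existence of proximal points -/

/-- Convexity on the segment from `x₀` to `z`, which meets the unit sphere around `x₀`, where `g` is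
at least its minimum over the compact ball. Thus `g` falls at most linearly and a quadratic term
makes it coercive. -/
lemma IsGammaZero.exists_linear_minorant [ProperSpace E] {g : E → EReal} (h : IsGammaZero g)
    {x₀ : E} (hx₀ : g x₀ < ⊤) :
    ∃ K : ℝ, 0 ≤ K ∧ ∀ z, g z < ⊤ → 1 < ‖z - x₀‖ →
      (g x₀).toReal - K * ‖z - x₀‖ ≤ (g z).toReal := by
  obtain ⟨y, -, hy⟩ := (h.lsc.lowerSemicontinuousOn (Metric.closedBall x₀ 1)).exists_isMinOn
    (Metric.nonempty_closedBall.2 zero_le_one) (isCompact_closedBall x₀ 1)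
  have hyx : g y ≤ g x₀ := hy (Metric.mem_closedBall_self zero_le_one)
  have hyd : g y < ⊤ := hyx.trans_lt hx₀
  refine ⟨(g x₀).toReal - (g y).toReal,
    sub_nonneg.2 (EReal.toReal_le_toReal hyx (h.ne_bot y) hx₀.ne), fun z hz hd => ?_⟩
  set d := ‖z - x₀‖ with hd_def
  have hd0 : 0 < d := zero_lt_one.trans hd
  have hi : d⁻¹ < 1 := inv_lt_one_of_one_lt₀ hd
  obtain ⟨hlt, hle⟩ := h.toReal_convex (sub_pos.2 hi) (inv_pos.2 hd0) (by ring) hx₀ hz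
  have hmem : (1 - d⁻¹) • x₀ + d⁻¹ • z ∈ Metric.closedBall x₀ 1 := by
    have : (1 - d⁻¹) • x₀ + d⁻¹ • z - x₀ = d⁻¹ • (z - x₀) := by module
    rw [mem_closedBall_iff_norm, this, norm_smul, Real.norm_of_nonneg (inv_pos.2 hd0).le,
      ← hd_def, inv_mul_cancel₀ hd0.ne']
  have h1 : (g y).toReal ≤ (g ((1 - d⁻¹) • x₀ + d⁻¹ • z)).toReal :=
    EReal.toReal_le_toReal (hy hmem) (h.ne_bot y) hlt.ne
  have h2 := mul_le_mul_of_nonneg_left (h1.trans hle) hd0.le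
  have h3 : d * ((1 - d⁻¹) * (g x₀).toReal + d⁻¹ * (g z).toReal) =
      d * (g x₀).toReal - (g x₀).toReal + (g z).toReal := by
    field_simp
  rw [h3] at h2
  linarith

omit [InnerProductSpace ℝ E] in
lemma lowerSemicontinuous_add_coe {g : E → EReal} (hg : LowerSemicontinuous g) {c : E → ℝ}
    (hc : Continuous c) : LowerSemicontinuous fun z => g z + (c z : EReal) :=
  hg.add' (continuous_coe_real_ereal.comp hc).lowerSemicontinuous
    fun _ => EReal.continuousAt_add (Or.inr (EReal.coe_ne_bot _)) (Or.inr (EReal.coe_ne_top _))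

lemma IsGammaZero.exists_prox [ProperSpace E] {g : E → EReal} (h : IsGammaZero g) {lam : ℝ}
    (hlam : 0 < lam) (x : E) :
    ∃ y, ∀ z, g y + ((1 / (2 * lam) * ‖y - x‖ ^ 2 : ℝ) : EReal) ≤
      g z + ((1 / (2 * lam) * ‖z - x‖ ^ 2 : ℝ) : EReal) := by
  obtain ⟨x₀, hx₀⟩ := h.dom_nonempty
  have hx₀ : g x₀ < ⊤ := hx₀
  obtain ⟨K, hK, hmin⟩ := h.exists_linear_minorant hx₀
  set c := 1 / (2 * lam) with hc_def
  have hc : 0 < c := by positivity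
  set a := ‖x₀ - x‖ with ha_def
  -- Beyond radius `R`, `c * ((d - a)² - a²) = c * d * (d - 2a) ≥ K * d`, so `x₀` already does
  -- better; the summand `1` puts `z` in the range of the linear minorant.
  set R := 1 + 2 * a + K / c with hR
  have ha : 0 ≤ a := norm_nonneg _
  have hKc : 0 ≤ K / c := by positivity
  have hR0 : 0 ≤ R := by positivity
  have hlsc := lowerSemicontinuous_add_coe h.lsc
    (c := fun z => c * ‖z - x‖ ^ 2) (by fun_prop)
  obtain ⟨y, -, hy⟩ := (hlsc.lowerSemicontinuousOn (Metric.closedBall x₀ R)).exists_isMinOn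
    (Metric.nonempty_closedBall.2 hR0) (isCompact_closedBall x₀ R)
  refine ⟨y, fun z => ?_⟩
  by_cases hz : z ∈ Metric.closedBall x₀ R
  · exact hy hz
  refine (hy (Metric.mem_closedBall_self hR0)).trans ?_
  rw [mem_closedBall_iff_norm, not_le] at hz
  by_cases hzt : g z < ⊤
  swap
  · rw [not_lt_top_iff.1 hzt, EReal.top_add_coe]
    exact le_top
  have h1 := hmin z hzt (by linarith)
  have h2 : ‖z - x₀‖ - a ≤ ‖z - x‖ := by
    have := norm_sub_norm_le (z - x₀) (x - x₀)
    rw [sub_sub_sub_cancel_right, norm_sub_rev x x₀] at this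
    exact this
  set d := ‖z - x₀‖
  have h3 : (d - a) ^ 2 ≤ ‖z - x‖ ^ 2 := pow_le_pow_left₀ (by linarith) h2 2
  have h4 : K ≤ c * (d - 2 * a) := by
    rw [← div_le_iff₀' hc]; linarith
  have h5 : K * d ≤ c * (d - 2 * a) * d := mul_le_mul_of_nonneg_right h4 (by linarith)
  have h6 := mul_le_mul_of_nonneg_left h3 hc.le
  simp only
  rw [← EReal.coe_toReal hx₀.ne (h.ne_bot x₀), ← EReal.coe_toReal hzt.ne (h.ne_bot z),
    ← EReal.coe_add, ← EReal.coe_add, EReal.coe_le_coe_iff]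
  nlinarith

lemma le_of_forall_le_add_mul {a b k : ℝ} (h : ∀ s, 0 < s → s < 1 → a ≤ b + s * k) : a ≤ b := by
  have ht : Tendsto (fun s : ℝ => b + s * k) (𝓝[>] 0) (𝓝 (b + 0 * k)) :=
    (Continuous.tendsto (by fun_prop) 0).mono_left nhdsWithin_le_nhds
  rw [zero_mul, add_zero] at ht
  refine ge_of_tendsto ht ?_
  filter_upwards [Ioo_mem_nhdsGT zero_lt_one] with s hs using h s hs.1 hs.2

/-- The optimality condition of the proximal problem. -/
lemma IsGammaZero.prox_mem_subdiff [ProperSpace E] {g : E → EReal} (h : IsGammaZero g) {lam : ℝ}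
    (hlam : 0 < lam) (x : E) :
    lam⁻¹ • (x - prox lam g x) ∈ subdiff g (prox lam g x) := by
  have hspec : ∀ z, g (prox lam g x) + ((1 / (2 * lam) * ‖prox lam g x - x‖ ^ 2 : ℝ) : EReal) ≤
      g z + ((1 / (2 * lam) * ‖z - x‖ ^ 2 : ℝ) : EReal) :=
    Classical.epsilon_spec (h.exists_prox hlam x)
  set y := prox lam g x
  have hy : g y < ⊤ := by
    obtain ⟨x₀, hx₀⟩ := h.dom_nonempty
    by_contra hcon
    have := hspec x₀
    rw [not_lt_top_iff.1 hcon, EReal.top_add_coe, top_le_iff] at this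
    have hx₀ : g x₀ < ⊤ := hx₀
    rw [← EReal.coe_toReal hx₀.ne (h.ne_bot x₀), ← EReal.coe_add] at this
    exact EReal.coe_ne_top _ this
  refine (mem_subdiff_iff h.ne_bot).2 ⟨hy, fun z hz => ?_⟩
  -- Compare the minimizer `y` with `(1 - s) y + s z`, divide by `s` and let `s → 0`; only the
  -- quadratic term carries a leftover factor `s`.
  refine le_of_forall_le_add_mul (k := 1 / (2 * lam) * ‖z - y‖ ^ 2) fun s hs hs1 => ?_
  obtain ⟨hlt, hle⟩ := h.toReal_convex (sub_pos.2 hs1) hs (by ring) hy hz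
  have hopt := hspec ((1 - s) • y + s • z)
  have hnorm : ‖(1 - s) • y + s • z - x‖ ^ 2 =
      ‖y - x‖ ^ 2 - 2 * s * inner ℝ (x - y) (z - y) + s ^ 2 * ‖z - y‖ ^ 2 := by
    have : (1 - s) • y + s • z - x = (y - x) + s • (z - y) := by module
    rw [this, norm_add_sq_real, inner_smul_right, norm_smul, ← neg_sub x y, inner_neg_left,
      mul_pow, Real.norm_eq_abs, sq_abs]
    ring
  rw [hnorm, ← EReal.coe_toReal hy.ne (h.ne_bot y), ← EReal.coe_toReal hlt.ne (h.ne_bot _),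
    ← EReal.coe_add, ← EReal.coe_add, EReal.coe_le_coe_iff] at hopt
  rw [inner_smul_left, RCLike.conj_to_real]
  have h1 : s * ((g y).toReal + lam⁻¹ * inner ℝ (x - y) (z - y)) ≤
      s * ((g z).toReal + s * (1 / (2 * lam) * ‖z - y‖ ^ 2)) := by
    have : 1 / (2 * lam) * (2 * s * inner ℝ (x - y) (z - y)) =
        s * (lam⁻¹ * inner ℝ (x - y) (z - y)) := by field_simp
    linarith
  exact le_of_mul_le_mul_left h1 hs

/-! ### Minimizing movements and the evolution variational inequality -/

lemma half_sq_norm_sub_le {x y z : E} :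
    ‖y - z‖ ^ 2 / 2 - ‖x - z‖ ^ 2 / 2 ≤ inner ℝ (x - y) (z - y) := by
  have h : ‖x - z‖ ^ 2 = ‖x - y‖ ^ 2 - 2 * inner ℝ (x - y) (z - y) + ‖y - z‖ ^ 2 := by
    rw [← norm_sub_rev z y, ← norm_sub_sq_real, sub_sub_sub_cancel_right]
  nlinarith [sq_nonneg ‖x - y‖]

lemma IsGammaZero.prox_lt_top [ProperSpace E] {φ : E → EReal} (h : IsGammaZero φ) {τ : ℝ}
    (hτ : 0 < τ) (x : E) : φ (prox τ φ x) < ⊤ :=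
  (h.prox_mem_subdiff hτ x).1

lemma IsGammaZero.prox_evi [ProperSpace E] {φ : E → EReal} (h : IsGammaZero φ) {τ : ℝ}
    (hτ : 0 < τ) (x : E) {z : E} (hz : φ z < ⊤) :
    ‖prox τ φ x - z‖ ^ 2 / 2 - ‖x - z‖ ^ 2 / 2 ≤
      τ * ((φ z).toReal - (φ (prox τ φ x)).toReal) := by
  have h1 := ((mem_subdiff_iff h.ne_bot).1 (h.prox_mem_subdiff hτ x)).2 z hz
  rw [inner_smul_left, RCLike.conj_to_real] at h1
  have h2 : τ * (τ⁻¹ * inner ℝ (x - prox τ φ x) (z - prox τ φ x)) ≤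
      τ * ((φ z).toReal - (φ (prox τ φ x)).toReal) :=
    mul_le_mul_of_nonneg_left (by linarith) hτ.le
  rw [mul_inv_cancel_left₀ hτ.ne'] at h2
  exact half_sq_norm_sub_le.trans h2

lemma IsGammaZero.iterate_prox_lt_top [ProperSpace E] {φ : E → EReal} (h : IsGammaZero φ) {τ : ℝ}
    (hτ : 0 < τ) {x : E} (hx : φ x < ⊤) (k : ℕ) : φ ((prox τ φ)^[k] x) < ⊤ := by
  cases k with
  | zero => exact hx
  | succ k => rw [Function.iterate_succ_apply']; exact h.prox_lt_top hτ _

lemma IsGammaZero.toReal_prox_le [ProperSpace E] {φ : E → EReal} (h : IsGammaZero φ) {τ : ℝ}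
    (hτ : 0 < τ) {x : E} (hx : φ x < ⊤) : (φ (prox τ φ x)).toReal ≤ (φ x).toReal := by
  have h1 := h.prox_evi hτ x hx
  rw [sub_self, norm_zero] at h1
  have h2 : 0 ≤ τ * ((φ x).toReal - (φ (prox τ φ x)).toReal) := by
    nlinarith [sq_nonneg ‖prox τ φ x - x‖]
  linarith [nonneg_of_mul_nonneg_right h2 hτ]

/-- The one-step inequalities telescope; since `φ` decreases along the iterates, each intermediate
value may be replaced by the last. -/
lemma IsGammaZero.iterate_prox_evi [ProperSpace E] {φ : E → EReal} (h : IsGammaZero φ) {τ : ℝ}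
    (hτ : 0 < τ) {x : E} (hx : φ x < ⊤) {z : E} (hz : φ z < ⊤) (j : ℕ) :
    ‖(prox τ φ)^[j] x - z‖ ^ 2 / 2 - ‖x - z‖ ^ 2 / 2 ≤
      j * τ * ((φ z).toReal - (φ ((prox τ φ)^[j] x)).toReal) := by
  induction j with
  | zero => simp
  | succ j ih =>
    rw [Function.iterate_succ_apply']
    set y := (prox τ φ)^[j] x
    have h1 := h.prox_evi hτ y hz
    have h2 : (φ (prox τ φ y)).toReal ≤ (φ y).toReal :=
      h.toReal_prox_le hτ (h.iterate_prox_lt_top hτ hx j)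
    have h3 : (j : ℝ) * τ * ((φ z).toReal - (φ y).toReal) ≤
        j * τ * ((φ z).toReal - (φ (prox τ φ y)).toReal) :=
      mul_le_mul_of_nonneg_left (by linarith) (by positivity)
    push_cast
    linarith

/-- The gradient flow of `φ` issued from a point of its domain, in the sense of the evolution
variational inequality. -/
theorem IsGammaZero.exists_evi_curve [ProperSpace E] {φ : E → EReal} (h : IsGammaZero φ)
    (hm : AttainsMin φ) {x : E} (hx : φ x < ⊤) :
    ∃ χ : ℝ → E, χ 0 = x ∧ (∀ t, 0 ≤ t → φ (χ t) < ⊤) ∧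
      ∀ s t, 0 ≤ s → s ≤ t → ∀ z, φ z < ⊤ →
        ‖χ t - z‖ ^ 2 / 2 - ‖χ s - z‖ ^ 2 / 2 ≤ (t - s) * ((φ z).toReal - (φ (χ t)).toReal) := by
  obtain ⟨p, hp⟩ := h.crit_nonempty hm
  -- `u t n` is the implicit Euler scheme of step `1 / (n + 1)` stopped after `⌊t (n + 1)⌋` steps,
  -- i.e. near time `t`.
  let τ : ℕ → ℝ := fun n => 1 / ((n : ℝ) + 1)
  have hτ : ∀ n, 0 < τ n := fun n => by positivity
  let N : ℝ → ℕ → ℕ := fun t n => ⌊t * ((n : ℝ) + 1)⌋₊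
  let u : ℝ → ℕ → E := fun t n => (prox (τ n) φ)^[N t n] x
  have hdom : ∀ t n, φ (u t n) < ⊤ := fun t n => h.iterate_prox_lt_top (hτ n) hx _
  have hevi : ∀ s t, s ≤ t → ∀ n, ∀ z, φ z < ⊤ →
      ‖u t n - z‖ ^ 2 / 2 - ‖u s n - z‖ ^ 2 / 2 ≤
        ((N t n : ℝ) - N s n) * τ n * ((φ z).toReal - (φ (u t n)).toReal) := by
    intro s t hst n z hz
    have hN : N s n ≤ N t n := Nat.floor_le_floor (by gcongr)
    have := h.iterate_prox_evi (hτ n) (hdom s n) hz (N t n - N s n)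
    rwa [← Function.iterate_add_apply, Nat.sub_add_cancel hN, Nat.cast_sub hN] at this
  have hτN : ∀ t, 0 ≤ t → Tendsto (fun n => (N t n : ℝ) * τ n) (hyperfilter ℕ) (𝓝 t) := by
    intro t ht
    have h1 : Tendsto (fun n : ℕ => (n : ℝ) + 1) atTop atTop :=
      tendsto_atTop_add_const_right _ _ tendsto_natCast_atTop_atTop
    have h2 := ((tendsto_nat_floor_mul_div_atTop ht).comp h1).mono_left Nat.hyperfilter_le_atTop
    refine h2.congr fun n => ?_
    simp [N, τ, div_eq_mul_inv]
  have hle : ∀ t n, (φ (u t n)).toReal ≤ (φ x).toReal := by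
    intro t n
    have : ∀ k, (φ ((prox (τ n) φ)^[k] x)).toReal ≤ (φ x).toReal := by
      intro k
      induction k with
      | zero => simp
      | succ k ih =>
        rw [Function.iterate_succ_apply']
        exact (h.toReal_prox_le (hτ n) (h.iterate_prox_lt_top (hτ n) hx k)).trans ih
    exact this _
  have hu0 : ∀ n, u 0 n = x := fun n => by simp [u, N]
  have hbdd : ∀ t, 0 ≤ t → ∀ n,
      u t n ∈ Metric.closedBall x (√(2 * (t * ((φ x).toReal - (φ p).toReal)))) := by
    intro t ht n
    have h1 := hevi 0 t ht n x hx
    rw [hu0, sub_self, norm_zero] at h1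
    have h2 : (N t n : ℝ) * τ n ≤ t := by
      have : (N t n : ℝ) ≤ t * ((n : ℝ) + 1) := Nat.floor_le (by positivity)
      simp only [τ]
      rw [mul_one_div, div_le_iff₀ (by positivity)]
      exact this
    have h3 : (φ p).toReal ≤ (φ (u t n)).toReal := h.toReal_le hp (hdom t n)
    have h4 : (N t n : ℝ) * τ n * ((φ x).toReal - (φ (u t n)).toReal) ≤
        t * ((φ x).toReal - (φ p).toReal) :=
      mul_le_mul h2 (by linarith) (by linarith [hle t n]) ht
    rw [mem_closedBall_iff_norm]
    refine Real.le_sqrt_of_sq_le ?_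
    have h5 : (N 0 n : ℝ) = 0 := by simp [N]
    rw [h5, sub_zero] at h1
    linarith
  -- One nonprincipal ultrafilter serves all times at once, so boundedness at each `t` yields a
  -- pointwise limit without any Cauchy estimate or diagonal extraction.
  have hlim : ∀ t, ∃ y, 0 ≤ t → Tendsto (u t) (hyperfilter ℕ) (𝓝 y) := by
    intro t
    by_cases ht : 0 ≤ t
    · have hmem : ∀ᶠ n in (hyperfilter ℕ : Filter ℕ), u t n ∈ Metric.closedBall x _ :=
        Eventually.of_forall (hbdd t ht)
      obtain ⟨y, -, hy⟩ := (isCompact_closedBall x _).ultrafilter_le_nhds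
        ((hyperfilter ℕ).map (u t)) (le_principal_iff.2 hmem)
      exact ⟨y, fun _ => hy⟩
    · exact ⟨x, fun h => absurd h ht⟩
  choose χ hχ using hlim
  have hdomχ : ∀ t, 0 ≤ t → φ (χ t) < ⊤ := by
    intro t ht
    have : φ (χ t) ≤ ((φ x).toReal : EReal) := by
      refine (isClosed_sublevel h.lsc _).mem_of_tendsto (hχ t ht) (Eventually.of_forall fun n => ?_)
      rw [mem_ofPred_eq, ← EReal.coe_toReal (hdom t n).ne (h.ne_bot _), EReal.coe_le_coe_iff]
      exact hle t n
    exact this.trans_lt (EReal.coe_lt_top _)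
  refine ⟨χ, ?_, hdomχ, fun s t hs hst z hz => ?_⟩
  · refine tendsto_nhds_unique (hχ 0 le_rfl) ?_
    exact tendsto_const_nhds.congr fun n => (hu0 n).symm
  have ht := hs.trans hst
  -- Lower semicontinuity only gives `φ (u t n) > φ (χ t) - ε` eventually, which is the direction
  -- needed; `ε` is removed at the end.
  refine le_of_forall_le_add_mul (k := t - s) fun ε hε _ => ?_
  have hev : ∀ᶠ n in (hyperfilter ℕ : Filter ℕ),
      ‖u t n - z‖ ^ 2 / 2 - ‖u s n - z‖ ^ 2 / 2 ≤
        (N t n * τ n - N s n * τ n) * ((φ z).toReal - ((φ (χ t)).toReal - ε)) := by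
    have hlt : (((φ (χ t)).toReal - ε : ℝ) : EReal) < φ (χ t) := by
      nth_rewrite 2 [← EReal.coe_toReal (hdomχ t ht).ne (h.ne_bot _)]
      rw [EReal.coe_lt_coe_iff]
      linarith
    filter_upwards [hχ t ht (h.lsc (χ t) _ hlt)] with n hn
    have hn : (((φ (χ t)).toReal - ε : ℝ) : EReal) < φ (u t n) := hn
    rw [← EReal.coe_toReal (hdom t n).ne (h.ne_bot _), EReal.coe_lt_coe_iff] at hn
    refine (hevi s t hst n z hz).trans ?_
    rw [← sub_mul]
    refine mul_le_mul_of_nonneg_left (by linarith) (mul_nonneg ?_ (hτ n).le)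
    rw [sub_nonneg, Nat.cast_le]
    exact Nat.floor_le_floor (by gcongr)
  have key := le_of_tendsto_of_tendsto
    (((((hχ t ht).sub_const z).norm.pow 2).div_const 2).sub
      ((((hχ s hs).sub_const z).norm.pow 2).div_const 2))
    (((hτN t ht).sub (hτN s hs)).mul_const _) hev
  linarith

/-! ### Absolute continuity from a variation estimate -/

/-- Remove the interval with the largest right endpoint: by disjointness every other nondegenerate
interval ends before its left endpoint, which becomes the new `T`. -/
lemma sum_sub_le_of_antitoneOn {ι : Type*} {r : ℝ → ℝ} (hr : AntitoneOn r (Ici 0))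
    (a b : ι → ℝ) (s : Finset ι) :
    (∀ i ∈ s, a i ≤ b i ∧ 0 ≤ a i) →
    (s : Set ι).PairwiseDisjoint (fun i => Ioc (a i) (b i)) →
    ∀ T, 0 ≤ T → (∀ i ∈ s, a i < b i → b i ≤ T) →
    ∑ i ∈ s, (r (a i) - r (b i)) ≤ r 0 - r T := by
  classical
  induction s using Finset.induction_on_max_value b with
  | empty =>
    intro _ _ T hT _
    simpa using hr (mem_Ici.2 le_rfl) (mem_Ici.2 hT) hT
  | insert i s his hmax ih =>
    intro hab hdisj T hT hbT
    rw [Finset.sum_insert his]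
    have hab' : ∀ j ∈ s, a j ≤ b j ∧ 0 ≤ a j := fun j hj => hab j (Finset.mem_insert_of_mem hj)
    have hdisj' : (s : Set ι).PairwiseDisjoint (fun i => Ioc (a i) (b i)) :=
      hdisj.subset (by simp)
    obtain ⟨hi, hi0⟩ := hab i (Finset.mem_insert_self _ _)
    rcases hi.eq_or_lt with heq | hlt
    · rw [heq, sub_self, zero_add]
      exact ih hab' hdisj' T hT fun j hj => hbT j (Finset.mem_insert_of_mem hj)
    · have h1 := ih hab' hdisj' (a i) hi0 fun j hj hj' => by
        by_contra hcon
        have hne : i ≠ j := fun h => his (h ▸ hj)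
        exact Set.disjoint_left.1 (hdisj (by simp) (by simp [hj]) hne)
          (mem_Ioc.2 ⟨not_le.1 hcon, hmax j hj⟩) (mem_Ioc.2 ⟨hj', le_rfl⟩)
      have h2 : r T ≤ r (b i) :=
        hr (mem_Ici.2 (hi0.trans hi)) (mem_Ici.2 hT) (hbT i (Finset.mem_insert_self _ _) hlt)
      linarith

/-- By Cauchy–Schwarz the squared sum of increments is at most total length times total drop of `r`,
and the latter is bounded by `r 0 - r T`. -/
lemma absolutelyContinuousOnInterval_of_sq_dist_le {X : Type*} [PseudoMetricSpace X]
    {f : ℝ → X} {r : ℝ → ℝ} (hr : AntitoneOn r (Ici 0))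
    (hf : ∀ s t, 0 ≤ s → s ≤ t → dist (f s) (f t) ^ 2 ≤ (t - s) * (r s - r t))
    {T : ℝ} (hT : 0 ≤ T) : AbsolutelyContinuousOnInterval f 0 T := by
  rw [absolutelyContinuousOnInterval_iff]
  intro ε hε
  set C := r 0 - r T with hC_def
  have hC : 0 ≤ C := sub_nonneg.2 (hr (mem_Ici.2 le_rfl) (mem_Ici.2 hT) hT)
  refine ⟨ε ^ 2 / (C + 1), by positivity, fun I hI hlen => ?_⟩
  obtain ⟨hmem, hdisj⟩ := hI
  rw [uIcc_of_le hT] at hmem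
  let a : ℕ → ℝ := fun i => min (I.2 i).1 (I.2 i).2
  let b : ℕ → ℝ := fun i => max (I.2 i).1 (I.2 i).2
  have ha0 : ∀ i ∈ Finset.range I.1, 0 ≤ a i := fun i hi =>
    le_min (hmem i hi).1.1 (hmem i hi).2.1
  have hab : ∀ i, a i ≤ b i := fun i => min_le_max
  have hvar : ∑ i ∈ Finset.range I.1, (r (a i) - r (b i)) ≤ C :=
    sum_sub_le_of_antitoneOn hr a b _ (fun i hi => ⟨hab i, ha0 i hi⟩) hdisj T hT
      fun i hi _ => max_le (hmem i hi).1.2 (hmem i hi).2.2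
  have hd : ∀ i, dist (I.2 i).1 (I.2 i).2 = b i - a i := fun i => by
    rw [Real.dist_eq, ← max_sub_min_eq_abs']
  have hsq : ∀ i ∈ Finset.range I.1, dist (f (I.2 i).1) (f (I.2 i).2) ≤
      √(b i - a i) * √(r (a i) - r (b i)) := by
    intro i hi
    have h1 := hf (a i) (b i) (ha0 i hi) (hab i)
    have h2 : dist (f (a i)) (f (b i)) = dist (f (I.2 i).1) (f (I.2 i).2) := by
      simp only [a, b]
      rcases le_total (I.2 i).1 (I.2 i).2 with h | h
      · rw [min_eq_left h, max_eq_right h]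
      · rw [min_eq_right h, max_eq_left h, dist_comm]
    rw [← Real.sqrt_mul (sub_nonneg.2 (hab i)), ← h2]
    exact Real.le_sqrt_of_sq_le h1
  have hb : ∀ i ∈ Finset.range I.1, 0 ≤ r (a i) - r (b i) := fun i hi =>
    sub_nonneg.2 (hr (mem_Ici.2 (ha0 i hi)) (mem_Ici.2 ((ha0 i hi).trans (hab i))) (hab i))
  have hlen' : ∑ i ∈ Finset.range I.1, (b i - a i) < ε ^ 2 / (C + 1) := by
    simpa only [hd] using hlen
  have hCS := Finset.sum_mul_sq_le_sq_mul_sq (Finset.range I.1) (fun i => √(b i - a i))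
    (fun i => √(r (a i) - r (b i)))
  rw [Finset.sum_congr rfl fun i _ => Real.sq_sqrt (sub_nonneg.2 (hab i)),
    Finset.sum_congr rfl fun i hi => Real.sq_sqrt (hb i hi)] at hCS
  refine (Finset.sum_le_sum hsq).trans_lt (lt_of_pow_lt_pow_left₀ 2 hε.le (hCS.trans_lt ?_))
  have h0 : 0 ≤ ∑ i ∈ Finset.range I.1, (b i - a i) :=
    Finset.sum_nonneg fun i _ => sub_nonneg.2 (hab i)
  calc (∑ i ∈ Finset.range I.1, (b i - a i)) * ∑ i ∈ Finset.range I.1, (r (a i) - r (b i))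
      ≤ (∑ i ∈ Finset.range I.1, (b i - a i)) * (C + 1) :=
        mul_le_mul_of_nonneg_left (by linarith) h0
    _ < ε ^ 2 := (lt_div_iff₀ (by positivity)).1 hlen'

/-- The evolution variational inequality for a curve `χ` that starts in `dom φ`. -/
structure IsEVICurve (φ : E → EReal) (χ : ℝ → E) : Prop where
  lt_top : ∀ t, 0 ≤ t → φ (χ t) < ⊤
  evi : ∀ s t, 0 ≤ s → s ≤ t → ∀ z, φ z < ⊤ →
    ‖χ t - z‖ ^ 2 / 2 - ‖χ s - z‖ ^ 2 / 2 ≤ (t - s) * ((φ z).toReal - (φ (χ t)).toReal)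

/-! ### Regularity of EVI curves and the subgradient inclusion -/

namespace IsEVICurve

variable {φ : E → EReal} {χ : ℝ → E}

omit [InnerProductSpace ℝ E] in
lemma sq_dist_le (h : IsEVICurve φ χ) {s t : ℝ} (hs : 0 ≤ s) (hst : s ≤ t) :
    dist (χ s) (χ t) ^ 2 ≤ 2 * ((t - s) * ((φ (χ s)).toReal - (φ (χ t)).toReal)) := by
  have := h.evi s t hs hst (χ s) (h.lt_top s hs)
  rw [sub_self, norm_zero] at this
  rw [dist_eq_norm, norm_sub_rev]
  linarith

omit [InnerProductSpace ℝ E] in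
lemma antitoneOn (h : IsEVICurve φ χ) : AntitoneOn (fun t => (φ (χ t)).toReal) (Ici 0) := by
  intro s hs t _ hst
  rcases hst.eq_or_lt with rfl | hlt
  · exact le_rfl
  have h1 := h.sq_dist_le hs hst
  have h2 : 0 ≤ (t - s) * ((φ (χ s)).toReal - (φ (χ t)).toReal) := by
    nlinarith [sq_nonneg (dist (χ s) (χ t))]
  linarith [nonneg_of_mul_nonneg_right h2 (sub_pos.2 hlt)]

omit [InnerProductSpace ℝ E] in
lemma absolutelyContinuousOnInterval (h : IsEVICurve φ χ) {T : ℝ} (hT : 0 ≤ T) :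
    AbsolutelyContinuousOnInterval χ 0 T := by
  refine absolutelyContinuousOnInterval_of_sq_dist_le
    (r := fun t => 2 * (φ (χ t)).toReal) (fun s hs t ht hst => ?_) (fun s t hs hst => ?_) hT
  · exact mul_le_mul_of_nonneg_left (h.antitoneOn hs ht hst) zero_le_two
  · linarith [h.sq_dist_le hs hst]

/-- Scalar projections are what the fundamental theorem of calculus is later applied to. -/
lemma absolutelyContinuousOnInterval_inner (h : IsEVICurve φ χ) (u : E) {T : ℝ} (hT : 0 ≤ T) :
    AbsolutelyContinuousOnInterval (fun t => inner ℝ u (χ t)) 0 T := by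
  refine absolutelyContinuousOnInterval_of_sq_dist_le
    (r := fun t => ‖u‖ ^ 2 * (2 * (φ (χ t)).toReal)) (fun s hs t ht hst => ?_)
    (fun s t hs hst => ?_) hT
  · have := h.antitoneOn hs ht hst
    simp only at this ⊢
    gcongr
  · have h1 : dist (inner ℝ u (χ s)) (inner ℝ u (χ t) : ℝ) ≤ ‖u‖ * dist (χ s) (χ t) := by
      rw [Real.dist_eq, ← inner_sub_right, dist_eq_norm]
      exact abs_real_inner_le_norm _ _
    calc dist (inner ℝ u (χ s)) (inner ℝ u (χ t) : ℝ) ^ 2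
        ≤ (‖u‖ * dist (χ s) (χ t)) ^ 2 := by gcongr
      _ = ‖u‖ ^ 2 * dist (χ s) (χ t) ^ 2 := mul_pow _ _ _
      _ ≤ ‖u‖ ^ 2 * (2 * ((t - s) * ((φ (χ s)).toReal - (φ (χ t)).toReal))) := by
        gcongr; exact h.sq_dist_le hs hst
      _ = _ := by ring

/-- Differentiate the EVI in its left endpoint `s ↑ t`: the value `φ (χ t)` stays fixed, so no
continuity of `φ` along the curve is needed. -/
lemma neg_deriv_mem_subdiff (h : IsEVICurve φ χ) (hb : ∀ x, φ x ≠ ⊥) {t : ℝ} (ht : 0 < t) {v : E}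
    (hv : HasDerivAt χ v t) : -v ∈ subdiff φ (χ t) := by
  refine (mem_subdiff_iff hb).2 ⟨h.lt_top t ht.le, fun z hz => ?_⟩
  have hd : HasDerivAt (fun s => ‖χ s - z‖ ^ 2 / 2 +
      s * ((φ z).toReal - (φ (χ t)).toReal) * (-1)) (inner ℝ (χ t - z) v +
        1 * ((φ z).toReal - (φ (χ t)).toReal) * (-1)) t := by
    have h1 := ((hv.sub_const z).norm_sq.div_const 2)
    rw [mul_div_cancel_left₀ _ two_ne_zero] at h1
    exact h1.add (((hasDerivAt_id t).mul_const _).mul_const _)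
  have hle : inner ℝ (χ t - z) v + 1 * ((φ z).toReal - (φ (χ t)).toReal) * (-1) ≤ 0 := by
    have hslope := (hasDerivWithinAt_iff_tendsto_slope' (s := Iio t) (by simp)).1
      (hd.hasDerivWithinAt (s := Iio t))
    refine le_of_tendsto hslope ?_
    filter_upwards [Ioo_mem_nhdsLT ht] with s hs
    rw [slope_def_field]
    refine div_nonpos_of_nonneg_of_nonpos ?_ (by linarith [hs.2])
    have := h.evi s t hs.1.le hs.2.le z hz
    linarith
  have hin : inner ℝ (-v) (z - χ t) = inner ℝ (χ t - z) v := by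
    rw [inner_neg_left, ← inner_neg_right, neg_sub, real_inner_comm]
  rw [hin]
  linarith

lemma ae_differentiableAt [FiniteDimensional ℝ E] (h : IsEVICurve φ χ) :
    ∀ᵐ t ∂(volume.restrict (Ioi (0 : ℝ))), DifferentiableAt ℝ χ t := by
  rw [ae_restrict_iff' measurableSet_Ioi]
  have hn : ∀ n : ℕ, ∀ᵐ t : ℝ, t ∈ uIcc 0 (n : ℝ) → DifferentiableAt ℝ χ t := fun n =>
    (h.absolutelyContinuousOnInterval n.cast_nonneg).boundedVariationOn.ae_differentiableAt_of_mem_uIcc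
  filter_upwards [ae_all_iff.2 hn] with t ht ht0
  obtain ⟨n, hn⟩ := exists_nat_ge t
  refine ht n ?_
  rw [uIcc_of_le n.cast_nonneg]
  exact ⟨le_of_lt ht0, hn⟩

theorem isSubgradCurve [FiniteDimensional ℝ E] (h : IsEVICurve φ χ) (hb : ∀ x, φ x ≠ ⊥) :
    IsSubgradCurve φ (χ 0) χ where
  init := rfl
  absCont _ hT := h.absolutelyContinuousOnInterval hT
  deriv_mem := by
    filter_upwards [h.ae_differentiableAt, ae_restrict_mem measurableSet_Ioi] with t ht ht0
    exact ⟨_, ht.hasDerivAt, h.neg_deriv_mem_subdiff hb ht0 ht.hasDerivAt⟩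

end IsEVICurve

/-! ### Length of a subgradient curve under the residual bound -/

lemma ae_restrict_Icc_of_ae_restrict_Ioi {P : ℝ → Prop}
    (h : ∀ᵐ t ∂(volume.restrict (Ioi (0 : ℝ))), P t) (T : ℝ) :
    ∀ᵐ t ∂(volume.restrict (Icc 0 T)), P t := by
  rw [← Measure.restrict_congr_set Ioc_ae_eq_Icc]
  exact ae_restrict_of_ae_restrict_of_subset (fun t ht => ht.1) h

lemma AntitoneOn.ae_hasDerivAt_nonpos {q : ℝ → ℝ} (hq : AntitoneOn q (Ici 0)) :
    ∀ᵐ t ∂(volume.restrict (Ioi (0 : ℝ))), HasDerivAt q (deriv q t) t ∧ deriv q t ≤ 0 := by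
  have hm : MonotoneOn (-q) (Ioi 0) := hq.neg.mono Ioi_subset_Ici_self
  filter_upwards [hm.ae_differentiableWithinAt measurableSet_Ioi,
    ae_restrict_mem measurableSet_Ioi] with t ht ht0
  have hn : Ioi (0 : ℝ) ∈ 𝓝 t := Ioi_mem_nhds ht0
  have hd : HasDerivAt q (deriv q t) t := by
    have := (ht.differentiableAt hn).neg
    rw [neg_neg] at this
    exact this.hasDerivAt
  refine ⟨hd, ?_⟩
  have h1 : 0 ≤ derivWithin (-q) (Ioi 0) t := hm.derivWithin_nonneg
  rw [derivWithin_of_mem_nhds hn, hd.neg.deriv] at h1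
  linarith

/-- The square root of the objective gap along a curve. -/
noncomputable def sqrtGap (φ : E → EReal) (p : E) (χ : ℝ → E) (t : ℝ) : ℝ :=
  √((φ (χ t)).toReal - (φ p).toReal)

namespace IsEVICurve

variable {φ : E → EReal} {χ : ℝ → E} {p : E} {η : ℝ}

omit [InnerProductSpace ℝ E] in
lemma antitoneOn_sqrtGap (h : IsEVICurve φ χ) (p : E) : AntitoneOn (sqrtGap φ p χ) (Ici 0) :=
  fun _ hs _ ht hst => Real.sqrt_le_sqrt (sub_le_sub_right (h.antitoneOn hs ht hst) _)

/-- A chain rule without differentiating `φ`: as `-v` is a subgradient at `χ t`, the function `q² +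
⟪v, χ⟫` has a local minimum at `t`, so its derivative vanishes. -/
lemma deriv_sqrtGap_mul (h : IsEVICurve φ χ) (hφ : IsGammaZero φ) (hp : p ∈ crit φ) {t : ℝ}
    (ht : 0 < t) {v : E} {q' : ℝ} (hv : HasDerivAt χ v t) (hq : HasDerivAt (sqrtGap φ p χ) q' t) :
    2 * sqrtGap φ p χ t * q' = -‖v‖ ^ 2 := by
  have hsub := ((mem_subdiff_iff hφ.ne_bot).1 (h.neg_deriv_mem_subdiff hφ.ne_bot ht hv)).2
  have hsq : ∀ s, 0 ≤ s → sqrtGap φ p χ s ^ 2 = (φ (χ s)).toReal - (φ p).toReal := fun s hs =>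
    Real.sq_sqrt (sub_nonneg.2 (hφ.toReal_le hp (h.lt_top s hs)))
  have hd : HasDerivAt (fun s => sqrtGap φ p χ s ^ 2 + inner ℝ v (χ s))
      (2 * sqrtGap φ p χ t * q' + inner ℝ v v) t := by
    have h1 := hq.pow 2
    have h2 := (hasDerivAt_const t v).inner ℝ hv
    simpa [Pi.pow_def] using h1.fun_add h2
  have hmin : IsLocalMin (fun s => sqrtGap φ p χ s ^ 2 + inner ℝ v (χ s)) t := by
    filter_upwards [Ioi_mem_nhds ht] with s hs
    have hs : 0 < s := hs
    have := hsub (χ s) (h.lt_top s hs.le)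
    rw [inner_neg_left, inner_sub_right] at this
    rw [hsq s hs.le, hsq t ht.le]
    linarith
  have := hmin.hasDerivAt_eq_zero hd
  rw [real_inner_self_eq_norm_sq] at this
  linarith

lemma ae_deriv_bounds [FiniteDimensional ℝ E] (h : IsEVICurve φ χ) (hφ : IsGammaZero φ)
    (hp : p ∈ crit φ) (hη : 0 < η)
    (hres : ∀ᵐ t ∂(volume.restrict (Ioi (0 : ℝ))), ∀ v, -v ∈ subdiff φ (χ t) →
      η * sqrtGap φ p χ t ≤ ‖v‖) :
    ∀ᵐ t ∂(volume.restrict (Ioi (0 : ℝ))),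
      HasDerivAt χ (deriv χ t) t ∧ η * sqrtGap φ p χ t ≤ ‖deriv χ t‖ ∧
        η * ‖deriv χ t‖ ≤ 2 * deriv (-sqrtGap φ p χ) t := by
  filter_upwards [h.ae_differentiableAt, (h.antitoneOn_sqrtGap p).ae_hasDerivAt_nonpos, hres,
    ae_restrict_mem measurableSet_Ioi] with t hv hq hr ht
  have hv := hv.hasDerivAt
  set v := deriv χ t
  have hr := hr v (h.neg_deriv_mem_subdiff hφ.ne_bot ht hv)
  refine ⟨hv, hr, ?_⟩
  rw [hq.1.neg.deriv]
  have hmul := h.deriv_sqrtGap_mul hφ hp ht hv hq.1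
  rcases (norm_nonneg v).eq_or_lt with h0 | hpos
  · rw [← h0]; linarith [hq.2]
  · have h1 := mul_le_mul_of_nonneg_left hr (by linarith [hq.2] : 0 ≤ 2 * -deriv (sqrtGap φ p χ) t)
    -- Multiplied by `‖v‖`, the claim follows from `η ‖v‖² = η q (-2 q') ≤ ‖v‖ (-2 q')`.
    refine le_of_mul_le_mul_right ?_ hpos
    nlinarith

omit [InnerProductSpace ℝ E] in
-- Only monotonicity of `q` is available, hence an inequality (Lebesgue) instead of an equality;
-- upper bounds are all that is used.
lemma intervalIntegrable_deriv_neg_sqrtGap (h : IsEVICurve φ χ) {T : ℝ} (hT : 0 ≤ T) :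
    IntervalIntegrable (deriv (-sqrtGap φ p χ)) volume 0 T ∧
      ∫ t in (0 : ℝ)..T, deriv (-sqrtGap φ p χ) t ≤ sqrtGap φ p χ 0 - sqrtGap φ p χ T := by
  have hm : MonotoneOn (-sqrtGap φ p χ) (uIcc 0 T) := by
    rw [uIcc_of_le hT]
    exact (h.antitoneOn_sqrtGap p).neg.mono Icc_subset_Ici_self
  refine ⟨hm.intervalIntegrable_deriv, ?_⟩
  have h1 := hm.intervalIntegral_deriv_mem_uIcc
  have h2 : (-sqrtGap φ p χ) T - (-sqrtGap φ p χ) 0 = sqrtGap φ p χ 0 - sqrtGap φ p χ T := by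
    simp only [Pi.neg_apply]; ring
  rw [h2, uIcc_of_le (sub_nonneg.2
    (h.antitoneOn_sqrtGap p (mem_Ici.2 le_rfl) (mem_Ici.2 hT) hT))] at h1
  exact h1.2

variable [FiniteDimensional ℝ E]

/-- Integrate `-q' ≥ (η² / 2) q(t) ≥ (η² / 2) q(T)` over `[0, T]`. This `1 / T` rate is enough for
`q → 0`. -/
lemma sqrtGap_decay (h : IsEVICurve φ χ) (hφ : IsGammaZero φ) (hp : p ∈ crit φ) (hη : 0 < η)
    (hres : ∀ᵐ t ∂(volume.restrict (Ioi (0 : ℝ))), ∀ v, -v ∈ subdiff φ (χ t) →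
      η * sqrtGap φ p χ t ≤ ‖v‖) {T : ℝ} (hT : 0 ≤ T) :
    T * (η ^ 2 / 2 * sqrtGap φ p χ T) ≤ sqrtGap φ p χ 0 := by
  obtain ⟨hint, hle⟩ := h.intervalIntegrable_deriv_neg_sqrtGap (p := p) hT
  have hmono := intervalIntegral.integral_mono_ae_restrict hT
    (intervalIntegrable_const (c := η ^ 2 / 2 * sqrtGap φ p χ T)) hint (by
      filter_upwards [ae_restrict_Icc_of_ae_restrict_Ioi (h.ae_deriv_bounds hφ hp hη hres) T,
        ae_restrict_mem measurableSet_Icc] with t ht ht'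
      have h1 : sqrtGap φ p χ T ≤ sqrtGap φ p χ t :=
        h.antitoneOn_sqrtGap p (mem_Ici.2 ht'.1) (mem_Ici.2 hT) ht'.2
      have h2 : η * (η * sqrtGap φ p χ T) ≤ η * ‖deriv χ t‖ := by
        refine mul_le_mul_of_nonneg_left ?_ hη.le
        exact (mul_le_mul_of_nonneg_left h1 hη.le).trans ht.2.1
      linarith [ht.2.2])
  rw [intervalIntegral.integral_const, sub_zero, smul_eq_mul] at hmono
  have : 0 ≤ sqrtGap φ p χ T := Real.sqrt_nonneg _
  linarith

lemma norm_sub_le_sqrtGap (h : IsEVICurve φ χ) (hφ : IsGammaZero φ) (hp : p ∈ crit φ)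
    (hη : 0 < η)
    (hres : ∀ᵐ t ∂(volume.restrict (Ioi (0 : ℝ))), ∀ v, -v ∈ subdiff φ (χ t) →
      η * sqrtGap φ p χ t ≤ ‖v‖) {T : ℝ} (hT : 0 ≤ T) :
    η * ‖χ T - χ 0‖ ≤ 2 * sqrtGap φ p χ 0 := by
  -- Projecting the curve on its own displacement replaces the integral of a vector by that of `⟪u,
  -- χ'⟫ ≤ ‖u‖ ‖χ'‖`; at the end one divides by `‖u‖`.
  set u := χ T - χ 0 with hu
  obtain ⟨hint, hle⟩ := h.intervalIntegrable_deriv_neg_sqrtGap (p := p) hT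
  have hac := h.absolutelyContinuousOnInterval_inner u hT
  have hmono := intervalIntegral.integral_mono_ae_restrict hT
    (hac.intervalIntegrable_deriv.const_mul η) (hint.const_mul (‖u‖ * 2)) (by
      filter_upwards [ae_restrict_Icc_of_ae_restrict_Ioi (h.ae_deriv_bounds hφ hp hη hres) T]
        with t ht
      have h1 : HasDerivAt (fun s => inner ℝ u (χ s)) (inner ℝ u (deriv χ t)) t := by
        simpa using (hasDerivAt_const t u).inner ℝ ht.1
      rw [h1.deriv]
      calc η * inner ℝ u (deriv χ t) ≤ η * (‖u‖ * ‖deriv χ t‖) := by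
            gcongr; exact real_inner_le_norm _ _
        _ = ‖u‖ * (η * ‖deriv χ t‖) := by ring
        _ ≤ ‖u‖ * (2 * deriv (-sqrtGap φ p χ) t) :=
          mul_le_mul_of_nonneg_left ht.2.2 (norm_nonneg _)
        _ = _ := by ring)
  rw [intervalIntegral.integral_const_mul, intervalIntegral.integral_const_mul,
    hac.integral_deriv_eq_sub, ← inner_sub_right, ← hu, real_inner_self_eq_norm_sq] at hmono
  have hqT : 0 ≤ sqrtGap φ p χ T := Real.sqrt_nonneg _
  have hq0 : 0 ≤ sqrtGap φ p χ 0 := Real.sqrt_nonneg _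
  rcases (norm_nonneg u).eq_or_lt with h0 | hpos
  · rw [← h0]; linarith
  · refine le_of_mul_le_mul_left ?_ hpos
    have h2 : ‖u‖ * 2 * ∫ t in (0 : ℝ)..T, deriv (-sqrtGap φ p χ) t ≤
        ‖u‖ * 2 * sqrtGap φ p χ 0 := by gcongr; linarith
    linarith

/-- A curve along which the residual dominates the objective gap ends in a critical point whose
distance to the starting point is controlled by the initial gap. -/
theorem exists_crit_norm_sub_le (h : IsEVICurve φ χ) (hφ : IsGammaZero φ) (hp : p ∈ crit φ)
    (hη : 0 < η)
    (hres : ∀ᵐ t ∂(volume.restrict (Ioi (0 : ℝ))), ∀ v, -v ∈ subdiff φ (χ t) →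
      η * sqrtGap φ p χ t ≤ ‖v‖) :
    ∃ c ∈ crit φ, η * ‖χ 0 - c‖ ≤ 2 * sqrtGap φ p χ 0 := by
  have hmem : ∀ n : ℕ, χ n ∈ Metric.closedBall (χ 0) (2 * sqrtGap φ p χ 0 / η) := fun n => by
    rw [mem_closedBall_iff_norm, le_div_iff₀' hη]
    exact h.norm_sub_le_sqrtGap hφ hp hη hres n.cast_nonneg
  obtain ⟨c, hc, k, hk, hlim⟩ := (isCompact_closedBall _ _).tendsto_subseq hmem
  refine ⟨c, ?_, ?_⟩
  · have hφc : φ c ≤ φ p := by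
      -- The values along the curve tend to `φ p`, so each sublevel set `{φ ≤ y'}` with `y' > φ p`
      -- eventually contains the subsequence; being closed, it contains `c`.
      refine le_of_forall_gt fun y hy => ?_
      obtain ⟨y', hy', hyy⟩ := EReal.lt_iff_exists_real_btwn.1 hy
      refine lt_of_le_of_lt ?_ hyy
      have hq : Tendsto (fun n : ℕ => sqrtGap φ p χ n) atTop (𝓝 0) := by
        have hz : Tendsto (fun n : ℕ => (sqrtGap φ p χ 0 / (η ^ 2 / 2)) / (n : ℝ)) atTop (𝓝 0) :=
          tendsto_const_div_atTop_nhds_zero_nat _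
        refine tendsto_of_tendsto_of_tendsto_of_le_of_le' tendsto_const_nhds hz
          (Eventually.of_forall fun n => Real.sqrt_nonneg _) ?_
        filter_upwards [eventually_gt_atTop 0] with n hn
        have hn : (0 : ℝ) < n := Nat.cast_pos.2 hn
        have := h.sqrtGap_decay hφ hp hη hres hn.le
        rw [div_div, le_div_iff₀ (by positivity)]
        linarith
      have hφn : Tendsto (fun n : ℕ => (φ (χ n)).toReal) atTop (𝓝 (φ p).toReal) := by
        have h1 := (hq.pow 2).add_const (φ p).toReal
        rw [zero_pow two_ne_zero, zero_add] at h1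
        refine h1.congr fun n => ?_
        rw [sqrtGap, Real.sq_sqrt
          (sub_nonneg.2 (hφ.toReal_le hp (h.lt_top n n.cast_nonneg))), sub_add_cancel]
      have hpy : (φ p).toReal < y' := by
        rwa [← EReal.coe_toReal (mem_crit_iff.1 hp).1.ne (hφ.ne_bot p), EReal.coe_lt_coe_iff] at hy'
      refine (isClosed_sublevel hφ.lsc y').mem_of_tendsto hlim ?_
      filter_upwards [hk.tendsto_atTop.eventually (hφn.eventually_lt_const hpy)] with n hn
      have hlt := h.lt_top (k n) (k n).cast_nonneg
      change φ (χ (k n)) ≤ y'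
      rw [← EReal.coe_toReal hlt.ne (hφ.ne_bot _),
        EReal.coe_le_coe_iff]
      exact le_of_lt hn
    exact hφ.mem_crit_iff_forall_le.2 fun z => hφc.trans ((mem_crit_iff.1 hp).2 z)
  · rwa [mem_closedBall_iff_norm, le_div_iff₀' hη, norm_sub_rev] at hc

end IsEVICurve

/-! ### The error bound conditions for a general residual -/

lemma CorEB.of_objEB {φ : E → EReal} {G : E → E} {Ω : Set E} {ω α : ℝ} (hω : 0 ≤ ω)
    (hcor : ∀ x ∈ Ω ∩ effDom φ, ∀ p ∈ crit φ, ω * objGap φ x ≤ inner ℝ (G x) (x - p))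
    (h : ObjEB φ α Ω) : CorEB φ G (α * ω / 2) Ω := by
  intro x hx
  refine le_iInf₂ fun p hp => EReal.coe_le_coe_iff.2 ?_
  have h1 := mul_le_mul_of_nonneg_left (h x hx) hω
  linarith [hcor x hx p hp.1]

variable [FiniteDimensional ℝ E]

lemma IsGammaZero.exists_critProj {φ : E → EReal} (hφ : IsGammaZero φ) (hm : AttainsMin φ)
    (x : E) : ∃ p ∈ critProj φ x, ‖x - p‖ = Metric.infDist x (crit φ) := by
  obtain ⟨p, hp, hd⟩ := hφ.isClosed_crit.exists_infDist_eq_dist (hφ.crit_nonempty hm) x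
  rw [dist_eq_norm] at hd
  refine ⟨p, ⟨hp, fun v hv => ?_⟩, hd.symm⟩
  rw [← hd, ← dist_eq_norm]
  exact Metric.infDist_le_dist_of_mem hv

lemma ResEB.of_corEB {φ : E → EReal} (hφ : IsGammaZero φ) (hm : AttainsMin φ) {G : E → E}
    {Ω : Set E} {ν : ℝ} (h : CorEB φ G ν Ω) : ResEB φ G ν Ω := by
  intro x hx
  obtain ⟨p, hp, hd⟩ := hφ.exists_critProj hm x
  have h1 := EReal.coe_le_coe_iff.1 ((h x hx).trans (iInf₂_le p hp))
  have h2 := h1.trans (real_inner_le_norm (G x) (x - p))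
  rw [hd] at h2
  rcases (Metric.infDist_nonneg (x := x) (s := crit φ)).eq_or_lt with h0 | hpos
  · rw [← h0, mul_zero]; exact norm_nonneg _
  · exact le_of_mul_le_mul_right (by linarith) hpos

lemma ResObjEB.of_resEB {φ : E → EReal} (hφ : IsGammaZero φ) (hm : AttainsMin φ) {G : E → E}
    {Ω : Set E} {ω κ : ℝ} (hκ : 0 < κ)
    (hcor : ∀ x ∈ Ω ∩ effDom φ, ∀ p ∈ crit φ, ω * objGap φ x ≤ inner ℝ (G x) (x - p))
    (h : ResEB φ G κ Ω) : ResObjEB φ G √(κ * ω) Ω := by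
  intro x hx
  obtain ⟨p, hp, hd⟩ := hφ.exists_critProj hm x
  have hgap : 0 ≤ objGap φ x := by
    rw [hφ.objGap_eq hp.1 hx.2]
    exact sub_nonneg.2 (hφ.toReal_le hp.1 hx.2)
  have h1 := (hcor x hx p hp.1).trans (real_inner_le_norm (G x) (x - p))
  have h2 := h x hx
  rw [← hd] at h2
  rw [← Real.sqrt_mul' _ hgap]
  refine Real.sqrt_le_iff.2 ⟨norm_nonneg _, ?_⟩
  have h3 := mul_le_mul_of_nonneg_left h1 hκ.le
  have h4 := mul_le_mul_of_nonneg_left h2 (norm_nonneg (G x))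
  linarith

/-- Flow from `x`: the curve stays in `Ω`, where the residual bound passes from `G` to every
subgradient, hence to the velocity. Squaring `η d ≤ 2 √gap` gives `α / 2 = η² / 4`. -/
lemma ObjEB.of_resObjEB {φ : E → EReal} (hφ : IsGammaZero φ) (hm : AttainsMin φ) {G : E → E}
    {Ω : Set E} {η : ℝ} (hη : 0 < η)
    (hres : ∀ x ∈ Ω ∩ effDom φ, ∀ v ∈ subdiff φ x, ‖G x‖ ≤ ‖v‖)
    (hflow : ∀ x ∈ Ω ∩ effDom φ, FlowStaysIn φ Ω x)
    (h : ResObjEB φ G η Ω) : ObjEB φ (η ^ 2 / 2) Ω := by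
  intro x hx
  obtain ⟨p, hp⟩ := hφ.crit_nonempty hm
  obtain ⟨χ, h0, hdom, hevi⟩ := hφ.exists_evi_curve hm hx.2
  have hχ : IsEVICurve φ χ := ⟨hdom, hevi⟩
  have hΩ := hflow x hx χ (h0 ▸ hχ.isSubgradCurve hφ.ne_bot)
  obtain ⟨c, hc, hle⟩ := hχ.exists_crit_norm_sub_le hφ hp hη (by
    filter_upwards [hΩ, ae_restrict_mem measurableSet_Ioi] with t ht ht0 v hv
    have hd : φ (χ t) < ⊤ := hdom t (le_of_lt ht0)
    have := (h (χ t) ⟨ht, hd⟩).trans (hres _ ⟨ht, hd⟩ _ hv)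
    rwa [norm_neg, hφ.objGap_eq hp hd] at this)
  rw [sqrtGap, h0, ← hφ.objGap_eq hp hx.2] at hle
  have hgap : 0 ≤ objGap φ x := by
    rw [hφ.objGap_eq hp hx.2]
    exact sub_nonneg.2 (hφ.toReal_le hp hx.2)
  have h1 : η * Metric.infDist x (crit φ) ≤ 2 * √(objGap φ x) := by
    refine le_trans (mul_le_mul_of_nonneg_left ?_ hη.le) hle
    rw [← dist_eq_norm]
    exact Metric.infDist_le_dist_of_mem hc
  have h2 := pow_le_pow_left₀ (mul_nonneg hη.le Metric.infDist_nonneg) h1 2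
  rw [mul_pow, mul_pow, Real.sq_sqrt hgap] at h2
  linarith

theorem IsGammaZero.errorBounds {φ : E → EReal} (hφ : IsGammaZero φ) (hm : AttainsMin φ)
    {G : E → E} {Ω : Set E} {ω : ℝ} (hω : 0 < ω)
    (hcor : ∀ x ∈ Ω ∩ effDom φ, ∀ p ∈ crit φ, ω * objGap φ x ≤ inner ℝ (G x) (x - p))
    (hres : ∀ x ∈ Ω ∩ effDom φ, ∀ v ∈ subdiff φ x, ‖G x‖ ≤ ‖v‖)
    (hflow : ∀ x ∈ Ω ∩ effDom φ, FlowStaysIn φ Ω x) :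
    EBEquivalent φ G Ω ∧ EBConstants ω φ G Ω := by
  have hC : EBConstants ω φ G Ω :=
    ⟨fun _ _ h => .of_objEB hω.le hcor h, fun _ _ h => .of_corEB hφ hm h,
      fun _ hκ h => .of_resEB hφ hm hκ hcor h, fun _ hη h => .of_resObjEB hφ hm hη hres hflow h⟩
  refine ⟨?_, hC⟩
  obtain ⟨h1, h2, h3, h4⟩ := hC
  unfold EBEquivalent
  tfae_have 3 → 1 := fun ⟨α, hα, h⟩ => ⟨_, by positivity, h1 α hα h⟩
  tfae_have 1 → 2 := fun ⟨ν, hν, h⟩ => ⟨_, hν, h2 ν hν h⟩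
  tfae_have 2 → 4 := fun ⟨κ, hκ, h⟩ => ⟨_, by positivity, h3 κ hκ h⟩
  tfae_have 4 → 3 := fun ⟨η, hη, h⟩ => ⟨_, by positivity, h4 η hη h⟩
  tfae_finish

/-! ### The least-norm subgradient -/

omit [FiniteDimensional ℝ E] in
lemma isClosed_subdiff {φ : E → EReal} (hb : ∀ x, φ x ≠ ⊥) (x : E) : IsClosed (subdiff φ x) := by
  by_cases hx : φ x < ⊤
  · have : subdiff φ x =
        ⋂ (z) (_ : φ z < ⊤), {v | (φ x).toReal + inner ℝ v (z - x) ≤ (φ z).toReal} := by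
      ext v
      simp [mem_subdiff_iff hb, hx]
    rw [this]
    exact isClosed_iInter fun z => isClosed_iInter fun _ =>
      isClosed_le (by fun_prop) continuous_const
  · convert isClosed_empty
    exact eq_empty_of_forall_notMem fun v hv => hx hv.1

lemma leastNormSubgrad_spec {φ : E → EReal} (hb : ∀ x, φ x ≠ ⊥) {x : E} (hx : x ∈ subdiffDom φ) :
    leastNormSubgrad φ x ∈ subdiff φ x ∧ ∀ w ∈ subdiff φ x, ‖leastNormSubgrad φ x‖ ≤ ‖w‖ := by
  have : ∃ v, v ∈ subdiff φ x ∧ ∀ w ∈ subdiff φ x, ‖v‖ ≤ ‖w‖ := by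
    obtain ⟨v, hv, hd⟩ := (isClosed_subdiff hb x).exists_infDist_eq_dist hx 0
    refine ⟨v, hv, fun w hw => ?_⟩
    rw [dist_zero_left] at hd
    rw [← hd, ← dist_zero_left]
    exact Metric.infDist_le_dist_of_mem hw
  exact Classical.epsilon_spec this

lemma setOf_leastNormSubgrad_eq_zero {φ : E → EReal} (hb : ∀ x, φ x ≠ ⊥) :
    {x ∈ subdiffDom φ | leastNormSubgrad φ x = 0} = crit φ := by
  ext x
  constructor
  · rintro ⟨hx, h0⟩
    have := (leastNormSubgrad_spec hb hx).1
    rwa [h0] at this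
  · intro hx
    refine ⟨⟨0, hx⟩, ?_⟩
    have := (leastNormSubgrad_spec hb ⟨0, hx⟩).2 0 hx
    rwa [norm_zero, norm_le_zero_iff] at this

theorem IsGammaZero.errorBounds_leastNormSubgrad {φ : E → EReal} (hφ : IsGammaZero φ)
    (hm : AttainsMin φ) {Ω : Set E} (hΩ : Ω ⊆ subdiffDom φ) (hinv : IsSubdiffInvariant φ Ω) :
    IsResidualSetting φ (subdiffDom φ) (leastNormSubgrad φ) ∧
      EBEquivalent φ (leastNormSubgrad φ) Ω ∧ EBConstants 1 φ (leastNormSubgrad φ) Ω := by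
  refine ⟨⟨hφ.crit_nonempty hm, hφ.isClosed_crit, setOf_leastNormSubgrad_eq_zero hφ.ne_bot⟩,
    hφ.errorBounds hm one_pos (fun x hx p hp => ?_)
      (fun x hx v hv => (leastNormSubgrad_spec hφ.ne_bot (hΩ hx.1)).2 v hv)
      fun x hx => hinv x ⟨hx.1, hΩ hx.1⟩⟩
  have := ((mem_subdiff_iff hφ.ne_bot).1 (leastNormSubgrad_spec hφ.ne_bot (hΩ hx.1)).1).2 p
    (mem_crit_iff.1 hp).1
  rw [one_mul, hφ.objGap_eq hp hx.2]
  rw [← neg_sub x p, inner_neg_right] at this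
  linarith

/-! ### Smooth convex functions -/

section Smooth

omit [FiniteDimensional ℝ E]
variable [CompleteSpace E] {f : E → ℝ}

lemma hasDerivAt_comp_lineMap (hf : Differentiable ℝ f) (x z : E) (s : ℝ) :
    HasDerivAt (fun s : ℝ => f (AffineMap.lineMap x z s))
      (inner ℝ (gradient f (AffineMap.lineMap x z s)) (z - x)) s := by
  simpa [Function.comp_def] using (hf _).hasGradientAt.hasFDerivAt.comp_hasDerivAt s
    (AffineMap.hasDerivAt_lineMap (a := x) (b := z))

lemma add_inner_gradient_le (hc : ConvexOn ℝ univ f) (hf : Differentiable ℝ f) (x z : E) :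
    f x + inner ℝ (gradient f x) (z - x) ≤ f z := by
  have h1 : ConvexOn ℝ univ (fun s : ℝ => f (AffineMap.lineMap x z s)) :=
    hc.comp_affineMap (AffineMap.lineMap x z)
  have h2 := h1.le_slope_of_hasDerivAt (mem_univ 0) (mem_univ 1) zero_lt_one
    (hasDerivAt_comp_lineMap hf x z 0)
  simp only [slope_def_field, AffineMap.lineMap_apply_zero, AffineMap.lineMap_apply_one, sub_zero,
    div_one] at h2
  linarith

/-- Along the segment, `f` minus the quadratic model has derivative at most zero by the Lipschitz
bound, so it decreases from `s = 0` to `s = 1`. -/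
lemma IsGradLipschitzConvex.le_quadratic {L : ℝ} (hf : IsGradLipschitzConvex L f) (x z : E) :
    f z ≤ f x + inner ℝ (gradient f x) (z - x) + L / 2 * ‖z - x‖ ^ 2 := by
  set k : ℝ → ℝ := fun s => f (AffineMap.lineMap x z s) -
    (s * inner ℝ (gradient f x) (z - x) + s ^ 2 * (L / 2 * ‖z - x‖ ^ 2)) with hk
  have hd : ∀ s, HasDerivAt k (inner ℝ (gradient f (AffineMap.lineMap x z s)) (z - x) -
      (1 * inner ℝ (gradient f x) (z - x) + 2 * s * (L / 2 * ‖z - x‖ ^ 2))) s := fun s => by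
    refine (hasDerivAt_comp_lineMap hf.differentiable x z s).sub
      (((hasDerivAt_id s).mul_const _).add (HasDerivAt.mul_const ?_ _))
    simpa using hasDerivAt_pow 2 s
  have hanti : AntitoneOn k (Icc 0 1) := by
    refine antitoneOn_of_deriv_nonpos (convex_Icc 0 1)
      (fun s _ => (hd s).continuousAt.continuousWithinAt)
      (fun s _ => (hd s).differentiableAt.differentiableWithinAt) fun s hs => ?_
    rw [interior_Icc] at hs
    rw [(hd s).deriv, one_mul, sub_add_eq_sub_sub, ← inner_sub_left]
    have h1 := real_inner_le_norm (gradient f (AffineMap.lineMap x z s) - gradient f x) (z - x)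
    have h2 := hf.lipschitz (AffineMap.lineMap x z s) x
    have h3 : ‖(AffineMap.lineMap x z s : E) - x‖ = s * ‖z - x‖ := by
      rw [AffineMap.lineMap_apply_module', add_sub_cancel_right, norm_smul,
        Real.norm_of_nonneg hs.1.le]
    rw [h3] at h2
    have h4 := mul_le_mul_of_nonneg_right h2 (norm_nonneg (z - x))
    linarith
  have := hanti (left_mem_Icc.2 zero_le_one) (right_mem_Icc.2 zero_le_one) zero_le_one
  simp only [hk, AffineMap.lineMap_apply_zero, AffineMap.lineMap_apply_one] at this
  linarith

lemma mem_subdiff_coe_iff (hc : ConvexOn ℝ univ f) (hf : Differentiable ℝ f) {x v : E} :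
    v ∈ subdiff (fun x => (f x : EReal)) x ↔ v = gradient f x := by
  rw [mem_subdiff_iff fun _ => EReal.coe_ne_bot _]
  simp only [EReal.coe_lt_top, EReal.toReal_coe, true_and, true_imp_iff]
  refine ⟨fun h => ?_, fun h z => h ▸ add_inner_gradient_le hc hf x z⟩
  have hmin : IsLocalMin (fun z => f z - inner ℝ v z) x := Eventually.of_forall fun z => by
    have := h z
    rw [inner_sub_right] at this
    linarith
  have hd := (hf x).hasGradientAt.hasFDerivAt.sub ((innerSL ℝ v).hasFDerivAt (x := x))
  have h0 := hmin.hasFDerivAt_eq_zero hd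
  have h1 := DFunLike.congr_fun h0 (gradient f x - v)
  simp only [sub_apply, InnerProductSpace.toDual_apply_apply,
    innerSL_apply_apply, zero_apply, ← inner_sub_left] at h1
  rw [inner_self_eq_zero, sub_eq_zero] at h1
  exact h1.symm

omit [CompleteSpace E] in
lemma isGammaZero_coe (hc : ConvexOn ℝ univ f) (hf : Continuous f) :
    IsGammaZero (fun x => (f x : EReal)) where
  ne_bot _ := EReal.coe_ne_bot _
  dom_nonempty := ⟨0, EReal.coe_lt_top _⟩
  lsc := (continuous_coe_real_ereal.comp hf).lowerSemicontinuous
  convex x y a b ha hb hab := by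
    simp only [← EReal.coe_mul, ← EReal.coe_add, EReal.coe_le_coe_iff]
    exact hc.2 (mem_univ x) (mem_univ y) ha.le hb.le hab

end Smooth

/-- An instance of the least-norm case, since `∂φ = {∇φ}` everywhere. -/
theorem IsC1Convex.errorBounds_gradient [CompleteSpace E] {φ : E → ℝ} (hφ : IsC1Convex φ)
    (hm : AttainsMin fun x => (φ x : EReal)) {Ω : Set E}
    (hinv : IsSubdiffInvariant (fun x => (φ x : EReal)) Ω) :
    IsResidualSetting (fun x => (φ x : EReal)) univ (gradient φ) ∧
      EBEquivalent (fun x => (φ x : EReal)) (gradient φ) Ω ∧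
      EBConstants 1 (fun x => (φ x : EReal)) (gradient φ) Ω := by
  have hd : Differentiable ℝ φ := hφ.contDiff.differentiable one_ne_zero
  have hΓ := isGammaZero_coe hφ.convex hd.continuous
  have hdom : subdiffDom (fun x => (φ x : EReal)) = univ :=
    eq_univ_of_forall fun x => ⟨_, (mem_subdiff_coe_iff hφ.convex hd).2 rfl⟩
  have hG : leastNormSubgrad (fun x => (φ x : EReal)) = gradient φ := funext fun x =>
    (mem_subdiff_coe_iff hφ.convex hd).1
      (leastNormSubgrad_spec hΓ.ne_bot (hdom ▸ mem_univ x)).1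
  have := hΓ.errorBounds_leastNormSubgrad hm (hdom ▸ subset_univ Ω) hinv
  rwa [hdom, hG] at this

/-! ### Composite functions and the proximal-gradient residual -/

section Composite

variable [CompleteSpace E] {f : E → ℝ} {g : E → EReal} {L t : ℝ}

omit [FiniteDimensional ℝ E] [CompleteSpace E] in
lemma IsGammaZero.coe_add (hg : IsGammaZero g) (hc : ConvexOn ℝ univ f) (hf : Continuous f) :
    IsGammaZero (fun x => (f x : EReal) + g x) where
  ne_bot x := by simp [EReal.add_eq_bot_iff, hg.ne_bot x]
  dom_nonempty := by
    obtain ⟨x, hx⟩ := hg.dom_nonempty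
    exact ⟨x, EReal.add_lt_top (EReal.coe_ne_top _) (ne_of_lt hx)⟩
  lsc := by simpa only [add_comm] using lowerSemicontinuous_add_coe hg.lsc hf
  convex x y a b ha hb hab := by
    have h1 : ((f (a • x + b • y) : ℝ) : EReal) ≤ (a * f x + b * f y : ℝ) :=
      EReal.coe_le_coe_iff.2 (hc.2 (mem_univ x) (mem_univ y) ha.le hb.le hab)
    refine (add_le_add h1 (hg.convex x y a b ha hb hab)).trans_eq ?_
    rw [EReal.coe_add, EReal.coe_mul, EReal.coe_mul,
      EReal.left_distrib_of_nonneg_of_ne_top (EReal.coe_nonneg.2 ha.le) (EReal.coe_ne_top a),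
      EReal.left_distrib_of_nonneg_of_ne_top (EReal.coe_nonneg.2 hb.le) (EReal.coe_ne_top b),
      add_add_add_comm]

omit [NormedAddCommGroup E] [InnerProductSpace ℝ E] [FiniteDimensional ℝ E] [CompleteSpace E] in
lemma coe_add_lt_top_iff {x : E} : (f x : EReal) + g x < ⊤ ↔ g x < ⊤ := by
  refine ⟨fun h => not_le.1 fun hg => ?_, fun h => EReal.add_lt_top (EReal.coe_ne_top _) h.ne⟩
  rw [top_le_iff.1 hg, EReal.coe_add_top] at h
  exact lt_irrefl _ h

omit [FiniteDimensional ℝ E] [CompleteSpace E] in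
lemma IsGammaZero.toReal_coe_add (hg : IsGammaZero g) {x : E} (hx : g x < ⊤) :
    ((f x : EReal) + g x).toReal = f x + (g x).toReal := by
  rw [EReal.toReal_add (EReal.coe_ne_top _) (EReal.coe_ne_bot _) hx.ne (hg.ne_bot x),
    EReal.toReal_coe]

omit [FiniteDimensional ℝ E] in
lemma mem_subdiff_coe_add_iff (hf : IsGradLipschitzConvex L f) (hg : IsGammaZero g) {x v : E} :
    v ∈ subdiff (fun x => (f x : EReal) + g x) x ↔ v - gradient f x ∈ subdiff g x := by
  rw [mem_subdiff_iff (hg.coe_add hf.convex hf.differentiable.continuous).ne_bot,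
    mem_subdiff_iff hg.ne_bot]
  simp only [coe_add_lt_top_iff]
  refine and_congr_right fun hx => ⟨fun h z hz => ?_, fun h z hz => ?_⟩
  · refine le_of_forall_le_add_mul (k := L / 2 * ‖z - x‖ ^ 2) fun s hs hs1 => ?_
    obtain ⟨hlt, hle⟩ := hg.toReal_convex (sub_pos.2 hs1) hs (by ring) hx hz
    have h1 := h _ hlt
    have h2 := hf.le_quadratic x ((1 - s) • x + s • z)
    have h3 : (1 - s) • x + s • z - x = s • (z - x) := by module
    rw [hg.toReal_coe_add hx, hg.toReal_coe_add hlt, h3, inner_smul_right] at h1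
    rw [h3, inner_smul_right, norm_smul, mul_pow, Real.norm_eq_abs, sq_abs] at h2
    rw [inner_sub_left]
    refine le_of_mul_le_mul_left ?_ hs
    linarith
  · have h1 := h z hz
    have h2 := add_inner_gradient_le hf.convex hf.differentiable x z
    rw [inner_sub_left] at h1
    rw [hg.toReal_coe_add hx, hg.toReal_coe_add hz]
    linarith

lemma proxResidual_sub_gradient_mem_subdiff (hg : IsGammaZero g) (ht : 0 < t) (x : E) :
    proxResidual f g t x - gradient f x ∈ subdiff g (fbStep f g t x) := by
  have h := hg.prox_mem_subdiff ht (x - t • gradient f x)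
  have he : t⁻¹ • (x - t • gradient f x - prox t g (x - t • gradient f x)) =
      proxResidual f g t x - gradient f x := by
    rw [proxResidual, fbStep, sub_right_comm, smul_sub, inv_smul_smul₀ ht.ne']
  rwa [he] at h

omit [FiniteDimensional ℝ E] in
lemma sub_fbStep (ht : 0 < t) (x : E) : x - fbStep f g t x = t • proxResidual f g t x := by
  rw [proxResidual, smul_inv_smul₀ ht.ne']

/-- Monotonicity of `∂g` between `x` and `x⁺`, with `v - ∇f x` and `R - ∇f x` as subgradients and `x
- x⁺ = t R`, gives `‖R‖² ≤ ⟪v, R⟫`. -/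
lemma norm_proxResidual_le (hf : IsGradLipschitzConvex L f) (hg : IsGammaZero g) (ht : 0 < t)
    {x v : E} (hv : v ∈ subdiff (fun x => (f x : EReal) + g x) x) :
    ‖proxResidual f g t x‖ ≤ ‖v‖ := by
  have h1 := (mem_subdiff_iff hg.ne_bot).1 ((mem_subdiff_coe_add_iff hf hg).1 hv)
  have h2 := (mem_subdiff_iff hg.ne_bot).1
    (proxResidual_sub_gradient_mem_subdiff (f := f) hg ht x)
  have h3 := h1.2 _ h2.1
  have h4 := h2.2 _ h1.1
  rw [← neg_sub x (fbStep f g t x), inner_neg_right] at h3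
  rw [sub_fbStep ht, inner_smul_right, inner_sub_left] at h3 h4
  rw [real_inner_self_eq_norm_sq] at h4
  have h5 : ‖proxResidual f g t x‖ ^ 2 ≤ inner ℝ v (proxResidual f g t x) :=
    le_of_mul_le_mul_left (by linarith) ht
  have h6 := h5.trans (real_inner_le_norm _ _)
  rcases (norm_nonneg (proxResidual f g t x)).eq_or_lt with h0 | hpos
  · rw [← h0]; exact norm_nonneg _
  · exact le_of_mul_le_mul_right (by linarith) hpos

lemma setOf_proxResidual_eq_zero (hf : IsGradLipschitzConvex L f) (hg : IsGammaZero g)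
    (ht : 0 < t) :
    {x ∈ univ | proxResidual f g t x = 0} = crit (fun x => (f x : EReal) + g x) := by
  ext x
  constructor
  · rintro ⟨-, h0⟩
    have h1 := sub_fbStep (f := f) (g := g) ht x
    have h2 := proxResidual_sub_gradient_mem_subdiff (f := f) hg ht x
    rw [h0, smul_zero, sub_eq_zero] at h1
    rw [h0, ← h1] at h2
    exact (mem_subdiff_coe_add_iff hf hg).2 h2
  · intro hx
    have := norm_proxResidual_le hf hg ht hx
    exact ⟨mem_univ x, by rwa [norm_zero, norm_le_zero_iff] at this⟩

/-- Add the subgradient inequality of `g` at `x⁺`, convexity of `f` at `x`, and the quadratic bound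
from `x` to `x⁺`; `t L ≤ 1` leaves `t / 2` of the term `t ‖R‖²`. -/
lemma le_inner_proxResidual (hL : 0 < L) (hf : IsGradLipschitzConvex L f) (hg : IsGammaZero g)
    (ht : 0 < t) (htL : t ≤ 1 / L) (x : E) {p : E} (hp : g p < ⊤) :
    f (fbStep f g t x) + (g (fbStep f g t x)).toReal - (f p + (g p).toReal) +
      t / 2 * ‖proxResidual f g t x‖ ^ 2 ≤ inner ℝ (proxResidual f g t x) (x - p) := by
  have h1 := ((mem_subdiff_iff hg.ne_bot).1
    (proxResidual_sub_gradient_mem_subdiff (f := f) hg ht x)).2 p hp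
  have h2 := add_inner_gradient_le hf.convex hf.differentiable x p
  have h3 := hf.le_quadratic x (fbStep f g t x)
  have hs := sub_fbStep (f := f) (g := g) ht x
  have e1 : p - fbStep f g t x = (p - x) + t • proxResidual f g t x := by
    rw [← hs]; abel
  have e2 : fbStep f g t x - x = -(t • proxResidual f g t x) := by rw [← hs]; abel
  rw [e1, inner_add_right, inner_smul_right, inner_sub_left, inner_sub_left,
    real_inner_self_eq_norm_sq] at h1
  rw [e2, inner_neg_right, inner_smul_right, norm_neg, norm_smul, mul_pow, Real.norm_eq_abs,
    sq_abs] at h3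
  rw [← neg_sub p x, inner_neg_right]
  have h4 : L / 2 * (t ^ 2 * ‖proxResidual f g t x‖ ^ 2) ≤
      t / 2 * ‖proxResidual f g t x‖ ^ 2 := by
    have : t * L ≤ 1 := (le_div_iff₀ hL).1 htL
    have h5 : t * L * (t / 2 * ‖proxResidual f g t x‖ ^ 2) ≤
        1 * (t / 2 * ‖proxResidual f g t x‖ ^ 2) :=
      mul_le_mul_of_nonneg_right this (by positivity)
    linarith
  linarith

theorem errorBounds_proxResidual {φ : E → EReal} {Ω : Set E} {ε : ℝ} (hL : 0 < L)
    (hf : IsGradLipschitzConvex L f) (hg : IsGammaZero g)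
    (hφ : φ = fun x => (f x : EReal) + g x) (hm : AttainsMin φ)
    (hflow : ∀ x ∈ Ω ∩ effDom φ, FlowStaysIn φ Ω x) (ht : 0 < t) (htL : t ≤ 1 / L)
    (hε : 0 < ε) (hεt : ε ≤ 2 / t)
    (hdec : ∀ x ∈ Ω ∩ effDom φ, (ε : EReal) * (φ x - φ (fbStep f g t x)) ≤
      ((‖proxResidual f g t x‖ ^ 2 : ℝ) : EReal)) :
    IsResidualSetting φ univ (proxResidual f g t) ∧ EBEquivalent φ (proxResidual f g t) Ω ∧
      EBConstants (t * ε / 2) φ (proxResidual f g t) Ω := by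
  subst hφ
  have hΓ := hg.coe_add hf.convex hf.differentiable.continuous
  refine ⟨⟨hΓ.crit_nonempty hm, hΓ.isClosed_crit, setOf_proxResidual_eq_zero hf hg ht⟩,
    hΓ.errorBounds hm (by positivity) (fun x hx p hp => ?_)
      (fun x _ v hv => norm_proxResidual_le hf hg ht hv) hflow⟩
  have hpd : g p < ⊤ := coe_add_lt_top_iff.1 (mem_crit_iff.1 hp).1
  have hxd : g x < ⊤ := coe_add_lt_top_iff.1 hx.2
  have hyd : g (fbStep f g t x) < ⊤ := (proxResidual_sub_gradient_mem_subdiff hg ht x).1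
  have h1 := le_inner_proxResidual hL hf hg ht htL x hpd
  have h2 := hdec x hx
  beta_reduce at h2
  have h3 := hΓ.toReal_le hp (coe_add_lt_top_iff.2 hyd)
  rw [hΓ.objGap_eq hp hx.2]
  simp only [hg.toReal_coe_add hpd, hg.toReal_coe_add hxd, hg.toReal_coe_add hyd] at h3 ⊢
  rw [← EReal.coe_toReal hxd.ne (hg.ne_bot x), ← EReal.coe_toReal hyd.ne (hg.ne_bot _),
    ← EReal.coe_add, ← EReal.coe_add, ← EReal.coe_sub, ← EReal.coe_mul,
    EReal.coe_le_coe_iff] at h2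
  -- With `ω = t ε / 2 ≤ 1`, the gap at `x⁺` dominates `ω` times itself, while `(t / 2) ‖R‖²`
  -- dominates `ω (φ x - φ x⁺)`; the sum is `ω` times the gap at `x`.
  have h4 : t * ε / 2 ≤ 1 := by
    have := (le_div_iff₀ ht).1 hεt
    linarith
  have h5 := mul_le_mul_of_nonneg_left h2 (by positivity : 0 ≤ t / 2)
  have h6 := mul_le_mul_of_nonneg_right h4 (sub_nonneg.2 h3)
  linarith

end Composite

end ErrorBound

theorem corollary4p2 {n : ℕ} :
    -- case 1: smooth convex functions and the gradient
    (∀ (φ : EuclideanSpace ℝ (Fin n) → ℝ) (Ω : Set (EuclideanSpace ℝ (Fin n))), IsC1Convex φ →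
      AttainsMin (fun x => (φ x : EReal)) →
      IsSubdiffInvariant (fun x => (φ x : EReal)) Ω →
      IsResidualSetting (fun x => (φ x : EReal)) univ (gradient φ) ∧
      EBEquivalent (fun x => (φ x : EReal)) (gradient φ) Ω ∧
      EBConstants 1 (fun x => (φ x : EReal)) (gradient φ) Ω) ∧
    -- case 2: proper lsc convex functions and the least-norm subgradient
    (∀ (φ : EuclideanSpace ℝ (Fin n) → EReal) (Ω : Set (EuclideanSpace ℝ (Fin n))), IsGammaZero φ → AttainsMin φ →
      Ω ⊆ subdiffDom φ → IsSubdiffInvariant φ Ω →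
      IsResidualSetting φ (subdiffDom φ) (leastNormSubgrad φ) ∧
      EBEquivalent φ (leastNormSubgrad φ) Ω ∧
      EBConstants 1 φ (leastNormSubgrad φ) Ω) ∧
    -- case 3: composite functions and the proximal-gradient residual
    (∀ (f : EuclideanSpace ℝ (Fin n) → ℝ) (g φ : EuclideanSpace ℝ (Fin n) → EReal) (Ω : Set (EuclideanSpace ℝ (Fin n))) (L t ε : ℝ), 0 < L →
      IsGradLipschitzConvex L f → IsGammaZero g → φ = (fun x => (f x : EReal) + g x) →
      AttainsMin φ →
      (∀ x ∈ Ω ∩ effDom φ, FlowStaysIn φ Ω x) →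
      0 < t → t ≤ 1 / L → 0 < ε → ε ≤ 2 / t →
      (∀ x ∈ Ω ∩ effDom φ, (ε : EReal) * (φ x - φ (fbStep f g t x)) ≤
        ((‖proxResidual f g t x‖ ^ 2 : ℝ) : EReal)) →
      IsResidualSetting φ univ (proxResidual f g t) ∧
      EBEquivalent φ (proxResidual f g t) Ω ∧
      EBConstants (t * ε / 2) φ (proxResidual f g t) Ω) :=
  ⟨fun _ _ hφ hm hinv => hφ.errorBounds_gradient hm hinv,
    fun _ _ hφ hm hΩ hinv => hφ.errorBounds_leastNormSubgrad hm hΩ hinv,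
    fun _ _ _ _ _ _ _ hL hf hg hφ hm hflow ht htL hε hεt hdec =>
      errorBounds_proxResidual hL hf hg hφ hm hflow ht htL hε hεt hdec⟩
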